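/- Let $0\le m\le n$ be integers, let $B=\{x\in\mathbb R^n:|x|<1\}$ be the open unit ball, and let $M\subset B$ be a smooth embedded $m$-dimensional submanifold without boundary which is closed as a subset of $B$ and which is minimal, i.e. its mean curvature vector vanishes identically. (The mean curvature vector at $x\in M$ is $\vec H=\sum_j H_j\,\vec n_j$, where, for smooth local defining functions $\rho_1,\dots,\rho_{n-m}$ of $M$ near $x$ whose gradients $\vec n_j=\nabla\rho_j$ are orthonormal along $M$, $H_j$ is the trace of the restriction of the Hessian $D^2\rho_j(x)$ to the tangent space $T_xM$.) If $a\in M$, then the $m$-dimensional volume $|M|\in[0,\infty]$ of $M$ satisfies $$ |M|\;\ge\;\omega_m\,(1-|a|^2)^{m/2}, $$ where $\omega_m$ is the volume of the unit ball in $\mathbb R^m$. -/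

import Mathlib

open MeasureTheory
open scoped ContDiff

noncomputable section

/-- `ρ₁, …, ρₚ` are smooth local defining functions on the open set `U` for the set `M ⊆ ℝⁿ`:
`M ∩ U` is their common zero set in `U`, and their differentials, identified with the gradients,
are linearly independent at every point of `M ∩ U`. -/
structure IsDefiningSystem {n p : ℕ} (M : Set (EuclideanSpace ℝ (Fin n)))
    (U : Set (EuclideanSpace ℝ (Fin n))) (ρ : Fin p → EuclideanSpace ℝ (Fin n) → ℝ) : Prop where
  isOpen : IsOpen U
  contDiffOn : ∀ j, ContDiffOn ℝ ∞ (ρ j) U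
  mem_iff : ∀ y ∈ U, y ∈ M ↔ ∀ j, ρ j y = 0
  linearIndependent : ∀ y ∈ M ∩ U, LinearIndependent ℝ (fun j => gradient (ρ j) y)

/-- A smooth (embedded, boundaryless) `m`-dimensional submanifold of `ℝⁿ`: near each of its
points it is cut out by `p = n - m` smooth functions with linearly independent differentials. -/
def IsSmoothSubmanifold {n : ℕ} (m : ℕ) (M : Set (EuclideanSpace ℝ (Fin n))) : Prop :=
  ∀ x ∈ M, ∃ (p : ℕ) (U : Set (EuclideanSpace ℝ (Fin n)))
    (ρ : Fin p → EuclideanSpace ℝ (Fin n) → ℝ),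
    m + p = n ∧ x ∈ U ∧ IsDefiningSystem M U ρ

/-- The tangent space at `x` of the common zero set of the `ρⱼ`: the orthogonal complement of
the gradients `∇ρⱼ(x)`. -/
def tangentSpaceOf {n p : ℕ} (ρ : Fin p → EuclideanSpace ℝ (Fin n) → ℝ)
    (x : EuclideanSpace ℝ (Fin n)) : Submodule ℝ (EuclideanSpace ℝ (Fin n)) :=
  (Submodule.span ℝ (Set.range fun j => gradient (ρ j) x))ᗮ

/-- The trace of the Hessian `D²f(x)` restricted to a linear subspace `T`, computed in an
orthonormal basis of `T` (it does not depend on the basis). -/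
def hessianTraceOn {n : ℕ} (f : EuclideanSpace ℝ (Fin n) → ℝ) (x : EuclideanSpace ℝ (Fin n))
    (T : Submodule ℝ (EuclideanSpace ℝ (Fin n))) : ℝ :=
  ∑ i, fderiv ℝ (fderiv ℝ f) x
    (stdOrthonormalBasis ℝ T i : EuclideanSpace ℝ (Fin n))
    (stdOrthonormalBasis ℝ T i : EuclideanSpace ℝ (Fin n))

/-- `H` is the mean curvature vector of `M` at `x`. Take local defining functions `ρⱼ` near `x`
whose gradients `nⱼ = ∇ρⱼ` are orthonormal along `M`. The components of the second fundamental
form are the Hessians of the `ρⱼ` restricted to the tangent space, and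
`H = ∑ⱼ Hⱼ nⱼ` with `Hⱼ` the trace of the `j`-th component. The result does not depend on the
choice of the `ρⱼ`. With this sign the mean curvature vector of a sphere points outwards. -/
def HasMeanCurvatureVector {n : ℕ} (M : Set (EuclideanSpace ℝ (Fin n)))
    (x H : EuclideanSpace ℝ (Fin n)) : Prop :=
  ∃ (p : ℕ) (U : Set (EuclideanSpace ℝ (Fin n)))
    (ρ : Fin p → EuclideanSpace ℝ (Fin n) → ℝ),
    x ∈ U ∧ IsDefiningSystem M U ρ ∧
    (∀ y ∈ M ∩ U, Orthonormal ℝ (fun j => gradient (ρ j) y)) ∧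
    H = ∑ j, hessianTraceOn (ρ j) x (tangentSpaceOf ρ x) • gradient (ρ j) x

/-- A minimal `m`-dimensional submanifold of `ℝⁿ`: a smooth submanifold whose mean curvature
vector vanishes at every point. -/
structure IsMinimalSubmanifold {n : ℕ} (m : ℕ) (M : Set (EuclideanSpace ℝ (Fin n))) : Prop where
  smooth : IsSmoothSubmanifold m M
  meanCurvature_eq_zero : ∀ x ∈ M, HasMeanCurvatureVector M x 0

end

/-! The proof is a monotonicity formula for balls with a moving centre. Put `l x = 1 - 2⟨a, x⟩ +
|a|²` and `u x = |x - a|² / l x` (`poleWeight`, `poleRatio`). The set `u ≤ s` is the ball with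
centre `(1 - s) a` and squared radius `s (1 - (1 - s)|a|²)`: it shrinks to `a` as `s → 0` and is the
unit ball at `s = 1`. The claim is that `s ^ (-m/2) |M ∩ {u ≤ s}|` is nondecreasing. Its limit at
`0` is at least `ω_m (1 - |a|²) ^ (m/2)`, because the small balls have radius about `√(s (1 -
|a|²))`; its limit at `1` is `|M|`.

Monotonicity comes from testing minimality with `W = -φ(u/t) (x - a) + t Φ(u/t) a`, where `φ` is a
smooth decreasing cutoff and `Φ'(w) = w φ'(w)`. With this `Φ` the cross terms in the tangential
divergence cancel, and what remains is at most `-(m φ + 2 w φ'(w))` at `w = u/t`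
(`tangentialDivergence_poleField_le`). The integral of the divergence over `M` is zero, so `t ^
(-m/2) ∫ φ(u/t)` has nonnegative derivative (`monotoneOn_poleRatio`).

The divergence theorem on `M` (`integral_tangentialDivergence_eq_zero`) is obtained from the one in
`ℝⁿ`. Near a point of `M`, `W` is projected to a field `Y` tangent to all level sets of the defining
functions `ρ`. On `M` the Euclidean divergence of `Y` is the tangential divergence of `W`, since the
mean curvature vanishes. As `Y` annihilates functions of `ρ`, `∫ χ(ρ) div Y = ∫ div (χ(ρ) Y) = 0`
for every `χ`. When `χ` concentrates at `0` the left side tends to the integral over `M`, since the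
gradients of `ρ` are orthonormal there (`tendsto_tubeIntegral`). -/

/-! ### Traces of operators compressed to a subspace. -/

section TraceOnSubspace

variable {E : Type*} [NormedAddCommGroup E] [InnerProductSpace ℝ E] [FiniteDimensional ℝ E]

/-- The trace of the compression of `A` to the subspace `T`. -/
noncomputable def traceOn (T : Submodule ℝ E) (A : E →L[ℝ] E) : ℝ :=
  LinearMap.trace ℝ E ((A : E →ₗ[ℝ] E) ∘ₗ (T.starProjection : E →ₗ[ℝ] E))

theorem sum_inner_orthonormalBasis_eq_traceOn {ι : Type*} [Fintype ι] {T : Submodule ℝ E}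
    (b : OrthonormalBasis ι ℝ T) (A : E →L[ℝ] E) :
    ∑ i, inner ℝ (b i : E) (A (b i)) = traceOn T A := by
  have h1 : (A : E →ₗ[ℝ] E) ∘ₗ (T.starProjection : E →ₗ[ℝ] E) =
      ((A : E →ₗ[ℝ] E) ∘ₗ T.subtype) ∘ₗ (T.orthogonalProjectionOnto : E →ₗ[ℝ] T) := by
    ext x; rfl
  rw [traceOn, h1, LinearMap.trace_comp_comm', LinearMap.trace_eq_sum_inner _ b]
  refine Finset.sum_congr rfl fun i _ => ?_
  simp

theorem traceOn_add (T : Submodule ℝ E) (A B : E →L[ℝ] E) :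
    traceOn T (A + B) = traceOn T A + traceOn T B := by
  simp [traceOn, LinearMap.add_comp]

theorem traceOn_smul (T : Submodule ℝ E) (c : ℝ) (A : E →L[ℝ] E) :
    traceOn T (c • A) = c * traceOn T A := by
  simp [traceOn, LinearMap.smul_comp]

theorem traceOn_sum {ι : Type*} (s : Finset ι) (T : Submodule ℝ E) (A : ι → E →L[ℝ] E) :
    traceOn T (∑ i ∈ s, A i) = ∑ i ∈ s, traceOn T (A i) := by
  classical
  induction s using Finset.induction_on with
  | empty => simp [traceOn]
  | insert i s hi ih => rw [Finset.sum_insert hi, Finset.sum_insert hi, traceOn_add, ih]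

theorem traceOn_id (T : Submodule ℝ E) :
    traceOn T (ContinuousLinearMap.id ℝ E) = Module.finrank ℝ T := by
  rw [← sum_inner_orthonormalBasis_eq_traceOn (stdOrthonormalBasis ℝ T)]
  have h (i) : ‖((stdOrthonormalBasis ℝ T i : T) : E)‖ = 1 := (stdOrthonormalBasis ℝ T).norm_eq_one i
  simp [h]

theorem traceOn_smulRight (T : Submodule ℝ E) (f : StrongDual ℝ E) (v : E) :
    traceOn T (f.smulRight v) = f (T.starProjection v) := by
  have h1 : (f.smulRight v : E →ₗ[ℝ] E) ∘ₗ (T.starProjection : E →ₗ[ℝ] E) =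
      ((f : E →ₗ[ℝ] ℝ) ∘ₗ (T.starProjection : E →ₗ[ℝ] E)).smulRight v := by
    ext x; simp
  rw [traceOn, h1, LinearMap.trace_smulRight]
  simp

theorem Orthonormal.starProjection_span_range {ι : Type*} [Fintype ι] {v : ι → E}
    (hv : Orthonormal ℝ v) (x : E) :
    (Submodule.span ℝ (Set.range v)).starProjection x = ∑ k, inner ℝ (v k) x • v k := by
  classical
  refine Submodule.eq_starProjection_of_mem_orthogonal ?_ ?_
  · exact Submodule.sum_mem _ fun k _ => Submodule.smul_mem _ _
      (Submodule.subset_span (Set.mem_range_self k))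
  · rw [Submodule.mem_orthogonal]
    intro u hu
    induction hu using Submodule.span_induction with
    | mem u hu =>
      obtain ⟨k, rfl⟩ := hu
      rw [inner_sub_right, hv.inner_right_fintype, sub_self]
    | zero => simp
    | add a b _ _ ha hb => rw [inner_add_left, ha, hb, add_zero]
    | smul c a _ ha => rw [inner_smul_left, ha, mul_zero]

/-- This form turns a Euclidean divergence, once its normal part is removed, into a tangential
divergence. -/
theorem Orthonormal.traceOn_orthogonal_span {ι : Type*} [Fintype ι] {v : ι → E}
    (hv : Orthonormal ℝ v) (A : E →L[ℝ] E) :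
    traceOn (Submodule.span ℝ (Set.range v))ᗮ A =
      LinearMap.trace ℝ E (A : E →ₗ[ℝ] E) - ∑ k, inner ℝ (v k) (A (v k)) := by
  have h1 : (A : E →ₗ[ℝ] E) ∘ₗ
      ((Submodule.span ℝ (Set.range v))ᗮ.starProjection : E →ₗ[ℝ] E) =
      (A : E →ₗ[ℝ] E) - ∑ k, ((innerSL ℝ (v k) : E →ₗ[ℝ] ℝ)).smulRight (A (v k)) := by
    ext x
    simp [Submodule.starProjection_orthogonal, hv.starProjection_span_range]
  rw [traceOn, h1, map_sub, map_sum]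
  simp [LinearMap.trace_smulRight]

end TraceOnSubspace

open Filter Topology

/-- `n`-dimensional Euclidean space. -/
abbrev Euc (n : ℕ) := EuclideanSpace ℝ (Fin n)

/-! ### Gradients and Hessians. -/

section Gradient

variable {n : ℕ}

theorem inner_gradient_left' (f : Euc n → ℝ) (x v : Euc n) :
    inner ℝ (gradient f x) v = fderiv ℝ f x v := by
  rw [← toDual_gradient, InnerProductSpace.toDual_apply_apply]

theorem gradient_eq_comp_fderiv (f : Euc n → ℝ) :
    gradient f = (InnerProductSpace.toDual ℝ (Euc n)).symm.toContinuousLinearEquiv ∘ fderiv ℝ f := rfl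

theorem ContDiffAt.gradient {f : Euc n → ℝ} {x : Euc n} {k l : ℕ∞ω} (hf : ContDiffAt ℝ k f x)
    (hkl : l + 1 ≤ k) : ContDiffAt ℝ l (gradient f) x := by
  rw [gradient_eq_comp_fderiv]
  exact (ContinuousLinearEquiv.contDiff _).contDiffAt.comp x (hf.fderiv_right hkl)

theorem inner_fderiv_gradient (f : Euc n → ℝ) (x v w : Euc n) :
    inner ℝ (fderiv ℝ (gradient f) x v) w = fderiv ℝ (fderiv ℝ f) x v w := by
  rw [gradient_eq_comp_fderiv, ContinuousLinearEquiv.comp_fderiv]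
  exact InnerProductSpace.toDual_symm_apply

theorem inner_fderiv_gradient_comm {f : Euc n → ℝ} {x : Euc n} (hf : ContDiffAt ℝ 2 f x)
    (v w : Euc n) :
    inner ℝ (fderiv ℝ (gradient f) x v) w = inner ℝ v (fderiv ℝ (gradient f) x w) := by
  rw [inner_fderiv_gradient, real_inner_comm, inner_fderiv_gradient]
  exact (hf.isSymmSndFDerivAt (by simp)) v w

theorem hessianTraceOn_eq_traceOn (f : Euc n → ℝ) (x : Euc n) (T : Submodule ℝ (Euc n)) :
    hessianTraceOn f x T = traceOn T (fderiv ℝ (gradient f) x) := by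
  rw [← sum_inner_orthonormalBasis_eq_traceOn (stdOrthonormalBasis ℝ T), hessianTraceOn]
  refine Finset.sum_congr rfl fun i _ => ?_
  rw [real_inner_comm, inner_fderiv_gradient]

theorem Orthonormal.eq_sum_inner_of_mem_span {ι E : Type*} [Fintype ι] [NormedAddCommGroup E]
    [InnerProductSpace ℝ E] [FiniteDimensional ℝ E] {v : ι → E} (hv : Orthonormal ℝ v) {x : E}
    (hx : x ∈ Submodule.span ℝ (Set.range v)) : x = ∑ k, inner ℝ (v k) x • v k := by
  rw [← hv.starProjection_span_range]
  exact (Submodule.starProjection_eq_self_iff.2 hx).symm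

end Gradient

theorem two_le_infty : (2 : ℕ∞ω) ≤ ∞ := by exact WithTop.coe_le_coe.2 (le_top (a := (2 : ℕ∞)))

/-! ### The normal space, and independence of mean curvature from the defining functions. -/

section NormalSpace

variable {n p : ℕ} {M U : Set (Euc n)} {ρ : Fin p → Euc n → ℝ} {x : Euc n}

/-- The normal space of `M` at `x`: the span of the gradients of the `C¹` functions which vanish
on `M` near `x`. -/
noncomputable def normalSpace (M : Set (Euc n)) (x : Euc n) : Submodule ℝ (Euc n) :=
  Submodule.span ℝ {v | ∃ f : Euc n → ℝ, ContDiffAt ℝ 1 f x ∧ (∀ᶠ y in 𝓝[M] x, f y = 0) ∧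
    gradient f x = v}

theorem IsDefiningSystem.contDiffAt (h : IsDefiningSystem M U ρ) (hx : x ∈ U) (j : Fin p) :
    ContDiffAt ℝ ∞ (ρ j) x :=
  (h.contDiffOn j).contDiffAt (h.isOpen.mem_nhds hx)

theorem IsDefiningSystem.eventually_eq_zero (h : IsDefiningSystem M U ρ) (hx : x ∈ U)
    (j : Fin p) : ∀ᶠ y in 𝓝[M] x, ρ j y = 0 := by
  filter_upwards [nhdsWithin_le_nhds (h.isOpen.mem_nhds hx), self_mem_nhdsWithin] with y hy hyM
  exact (h.mem_iff y hy).1 hyM j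

/-- Lagrange multipliers: `f` is constant on the common level set of the `ρⱼ`, hence has an extremum
there, and linear independence of the gradients forces the multiplier of `f` to be nonzero.
Consequently the normal space does not depend on the defining system. -/
theorem IsDefiningSystem.gradient_mem_span (h : IsDefiningSystem M U ρ) (hx : x ∈ M ∩ U)
    {f : Euc n → ℝ} (hf : ContDiffAt ℝ 1 f x) (hf0 : ∀ᶠ y in 𝓝[M] x, f y = 0) :
    gradient f x ∈ Submodule.span ℝ (Set.range fun j => gradient (ρ j) x) := by
  have hρx := (h.mem_iff x hx.2).1 hx.1
  have hfx : f x = 0 := hf0.self_of_nhdsWithin hx.1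
  have hmem : ∀ᶠ y in 𝓝[{y | ∀ i, ρ i y = ρ i x}] x, y ∈ M := by
    filter_upwards [nhdsWithin_le_nhds (h.isOpen.mem_nhds hx.2), self_mem_nhdsWithin] with y hy hy'
    refine (h.mem_iff y hy).2 fun j => ?_
    rw [← hρx j]; exact hy' j
  have hext : IsLocalExtrOn f {y | ∀ i, ρ i y = ρ i x} x := by
    left
    have h2 := (eventually_nhdsWithin_iff.1 hf0)
    filter_upwards [hmem, nhdsWithin_le_nhds h2] with y hy hy2
    rw [hfx, hy2 hy]
  obtain ⟨Λ, Λ₀, hne, hsum⟩ := hext.exists_multipliers_of_hasStrictFDerivAt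
    (fun i => (h.contDiffAt hx.2 i).hasStrictFDerivAt (by simp)) (hf.hasStrictFDerivAt (by simp))
  have hgrad : (∑ i, Λ i • gradient (ρ i) x) + Λ₀ • gradient f x = 0 := by
    refine ext_inner_right ℝ fun v => ?_
    have := congrArg (fun L => L v) hsum
    simpa [inner_add_left, sum_inner, inner_smul_left, inner_gradient_left'] using this
  have hΛ₀ : Λ₀ ≠ 0 := by
    rintro rfl
    rw [zero_smul, add_zero] at hgrad
    have := Fintype.linearIndependent_iff.1 (h.linearIndependent x hx) Λ hgrad
    exact hne (Prod.ext (funext this) rfl)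
  have heq : gradient f x = ∑ i, (-(Λ₀⁻¹ * Λ i)) • gradient (ρ i) x := by
    have h3 : Λ₀ • gradient f x = - ∑ i, Λ i • gradient (ρ i) x := by
      rw [eq_neg_iff_add_eq_zero, add_comm]; exact hgrad
    rw [← inv_smul_smul₀ hΛ₀ (gradient f x), h3, smul_neg, Finset.smul_sum, ← Finset.sum_neg_distrib]
    simp [smul_smul]
  rw [heq]
  exact Submodule.sum_mem _ fun k _ => Submodule.smul_mem _ _
    (Submodule.subset_span (Set.mem_range_self k))

theorem IsDefiningSystem.span_gradient_eq (h : IsDefiningSystem M U ρ) (hx : x ∈ M ∩ U) :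
    Submodule.span ℝ (Set.range fun j => gradient (ρ j) x) = normalSpace M x := by
  apply le_antisymm
  · refine Submodule.span_mono ?_
    rintro _ ⟨j, rfl⟩
    exact ⟨ρ j, (h.contDiffAt hx.2 j).of_le (by simp), h.eventually_eq_zero hx.2 j, rfl⟩
  · refine Submodule.span_le.2 ?_
    rintro _ ⟨f, hf, hf0, rfl⟩
    exact h.gradient_mem_span hx hf hf0

theorem IsDefiningSystem.finrank_normalSpace (h : IsDefiningSystem M U ρ) (hx : x ∈ M ∩ U) :
    Module.finrank ℝ (normalSpace M x) = p := by
  rw [← h.span_gradient_eq hx, finrank_span_eq_card (h.linearIndependent x hx), Fintype.card_fin]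

theorem inner_gradient_of_mem_orthogonal {f : Euc n → ℝ} (hf : ContDiffAt ℝ 1 f x)
    (hf0 : ∀ᶠ y in 𝓝[M] x, f y = 0) {τ : Euc n} (hτ : τ ∈ (normalSpace M x)ᗮ) :
    fderiv ℝ f x τ = 0 := by
  rw [← inner_gradient_left']
  exact (Submodule.mem_orthogonal _ _).1 hτ _ (Submodule.subset_span ⟨f, hf, hf0, rfl⟩)

/-- Local defining functions with orthonormal gradients along `M`. -/
structure IsOrthonormalSystem (M U : Set (Euc n)) (ρ : Fin p → Euc n → ℝ) : Prop
    extends IsDefiningSystem M U ρ where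
  orthonormal : ∀ y ∈ M ∩ U, Orthonormal ℝ (fun j => gradient (ρ j) y)

/-- A function vanishing on `M` to first order at `x` has no tangential Hessian there. This makes
second fundamental forms computed from different defining systems comparable. -/
theorem IsOrthonormalSystem.inner_fderiv_gradient_eq_zero (h : IsOrthonormalSystem M U ρ)
    (hx : x ∈ M ∩ U) {f : Euc n → ℝ} (hf : ContDiffAt ℝ 2 f x) (hf0 : ∀ᶠ y in 𝓝[M] x, f y = 0)
    (hfx : gradient f x = 0) {τ v : Euc n} (hτ : τ ∈ (normalSpace M x)ᗮ)
    (hv : v ∈ (normalSpace M x)ᗮ) : inner ℝ (fderiv ℝ (gradient f) x τ) v = 0 := by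
  have hgf : ContDiffAt ℝ 1 (gradient f) x := hf.gradient (by norm_num)
  have hgρ (j) : ContDiffAt ℝ 1 (gradient (ρ j)) x :=
    ((h.contDiffAt hx.2 j).of_le two_le_infty).gradient (by norm_num)
  -- `g` pairs `v` with `∇f` minus its normal projection. It vanishes on `M`, where `∇f` is normal,
  -- so its tangential derivatives vanish too. At `x` the correction terms contribute nothing, since
  -- `⟨∇ρₖ, v⟩ = 0` and `∇f = 0` there.
  set g : Euc n → ℝ := fun y => inner ℝ (gradient f y) v -
    ∑ k, inner ℝ (gradient (ρ k) y) v * inner ℝ (gradient (ρ k) y) (gradient f y) with hg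
  have hgC : ContDiffAt ℝ 1 g x := by
    refine (hgf.inner ℝ contDiffAt_const).sub (ContDiffAt.sum fun k _ => ?_)
    exact ((hgρ k).inner ℝ contDiffAt_const).mul ((hgρ k).inner ℝ hgf)
  have hg0 : ∀ᶠ y in 𝓝[M] x, g y = 0 := by
    have h1 : ∀ᶠ y in 𝓝[M] x, ContDiffAt ℝ 2 f y :=
      nhdsWithin_le_nhds (hf.eventually (by simp))
    have h2 : ∀ᶠ y in 𝓝[M] x, ∀ᶠ z in 𝓝[M] y, f z = 0 :=
      eventually_eventually_nhdsWithin.2 hf0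
    filter_upwards [h1, h2, nhdsWithin_le_nhds (h.isOpen.mem_nhds hx.2), self_mem_nhdsWithin]
      with y hy1 hy2 hyU hyM
    have h3 := h.gradient_mem_span ⟨hyM, hyU⟩ (hy1.of_le (by norm_num)) hy2
    have h4 := (h.orthonormal y ⟨hyM, hyU⟩).eq_sum_inner_of_mem_span h3
    have h5 : inner ℝ (gradient f y) v =
        ∑ k, inner ℝ (gradient (ρ k) y) v * inner ℝ (gradient (ρ k) y) (gradient f y) := by
      conv_lhs => rw [h4]
      simp [sum_inner, inner_smul_left, mul_comm]
    simp only [hg, h5, sub_self]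
  have hzero := inner_gradient_of_mem_orthogonal hgC hg0 hτ
  have hvk (k) : inner ℝ (gradient (ρ k) x) v = 0 := by
    refine (Submodule.mem_orthogonal _ _).1 hv _ ?_
    rw [← h.span_gradient_eq hx]
    exact Submodule.subset_span (Set.mem_range_self k)
  have hdf : HasFDerivAt (gradient f) (fderiv ℝ (gradient f) x) x :=
    (hgf.differentiableAt (by simp)).hasFDerivAt
  have hdρ (k) : HasFDerivAt (gradient (ρ k)) (fderiv ℝ (gradient (ρ k)) x) x :=
    ((hgρ k).differentiableAt (by simp)).hasFDerivAt
  have hder : HasFDerivAt g _ x := (hdf.inner ℝ (hasFDerivAt_const v x)).sub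
    (HasFDerivAt.fun_sum (u := Finset.univ) fun k _ =>
      ((hdρ k).inner ℝ (hasFDerivAt_const v x)).mul ((hdρ k).inner ℝ hdf))
  rw [hder.fderiv] at hzero
  simpa [hvk, hfx] using hzero

/-- The zero mean curvature is witnessed at each point by some system `σ`, possibly different from
`ρ`. The statement transfers it to one fixed system along a whole neighbourhood. -/
theorem IsOrthonormalSystem.traceOn_fderiv_gradient_eq_zero (h : IsOrthonormalSystem M U ρ)
    (hx : x ∈ M ∩ U) (hH : HasMeanCurvatureVector M x 0) (j : Fin p) :
    traceOn (normalSpace M x)ᗮ (fderiv ℝ (gradient (ρ j)) x) = 0 := by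
  obtain ⟨q, V, σ, hxV, hσ, hσo, hsum⟩ := hH
  have hxV' : x ∈ M ∩ V := ⟨hx.1, hxV⟩
  have htan : tangentSpaceOf σ x = (normalSpace M x)ᗮ := by
    rw [tangentSpaceOf, hσ.span_gradient_eq hxV']
  have hσ0 (k) : traceOn (normalSpace M x)ᗮ (fderiv ℝ (gradient (σ k)) x) = 0 := by
    have := Fintype.linearIndependent_iff.1 (hσ.linearIndependent x hxV') _ hsum.symm k
    rwa [hessianTraceOn_eq_traceOn, htan] at this
  set a : Fin q → ℝ := fun k => inner ℝ (gradient (σ k) x) (gradient (ρ j) x) with ha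
  have hρ2 : ContDiffAt ℝ 2 (ρ j) x := (h.contDiffAt hx.2 j).of_le two_le_infty
  have hσ2 (k) : ContDiffAt ℝ 2 (σ k) x := (hσ.contDiffAt hxV k).of_le two_le_infty
  -- The constants `a k` are the coordinates of `∇ρⱼ(x)` in the orthonormal frame `∇σₖ(x)`, so `f`
  -- vanishes on `M` and to first order at `x`.
  set f : Euc n → ℝ := fun y => ρ j y - ∑ k, a k * σ k y with hf
  have hfC : ContDiffAt ℝ 2 f x :=
    hρ2.sub (ContDiffAt.sum fun k _ => contDiffAt_const.mul (hσ2 k))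
  have hf0 : ∀ᶠ y in 𝓝[M] x, f y = 0 := by
    filter_upwards [h.eventually_eq_zero hx.2 j,
      eventually_all.2 fun k => hσ.eventually_eq_zero hxV k] with y hy1 hy2
    simp [hf, hy1, hy2]
  have hgrad : ∀ᶠ y in 𝓝 x, gradient f y = gradient (ρ j) y - ∑ k, a k • gradient (σ k) y := by
    filter_upwards [hρ2.eventually (by simp), eventually_all.2 fun k => (hσ2 k).eventually (by simp)]
      with y hy1 hy2
    refine ext_inner_right ℝ fun v => ?_
    have hd : HasFDerivAt f (fderiv ℝ (ρ j) y - ∑ k, a k • fderiv ℝ (σ k) y) y :=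
      (hy1.differentiableAt (by simp)).hasFDerivAt.sub (HasFDerivAt.fun_sum fun k _ =>
        ((hy2 k).differentiableAt (by simp)).hasFDerivAt.const_mul (a k))
    rw [inner_gradient_left', hd.fderiv]
    simp [inner_sub_left, sum_inner, inner_smul_left]
  have hgx : gradient f x = 0 := by
    rw [hgrad.self_of_nhds, sub_eq_zero]
    refine (hσo x hxV').eq_sum_inner_of_mem_span ?_
    rw [hσ.span_gradient_eq hxV', ← h.span_gradient_eq hx]
    exact Submodule.subset_span (Set.mem_range_self j)
  have hD : fderiv ℝ (gradient f) x =
      fderiv ℝ (gradient (ρ j)) x - ∑ k, a k • fderiv ℝ (gradient (σ k)) x := by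
    rw [Filter.EventuallyEq.fderiv_eq hgrad]
    exact ((((hρ2.gradient (l := 1) (by norm_num)).differentiableAt (by simp)).hasFDerivAt).sub
      (HasFDerivAt.fun_sum fun k _ =>
        (((hσ2 k).gradient (l := 1) (by norm_num)).differentiableAt
          (by simp)).hasFDerivAt.const_smul (a k))).fderiv
  have htf : traceOn (normalSpace M x)ᗮ (fderiv ℝ (gradient f) x) = 0 := by
    rw [← sum_inner_orthonormalBasis_eq_traceOn (stdOrthonormalBasis ℝ _)]
    refine Finset.sum_eq_zero fun i _ => ?_
    rw [real_inner_comm]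
    exact h.inner_fderiv_gradient_eq_zero hx hfC hf0 hgx (Subtype.mem _) (Subtype.mem _)
  have h6 : fderiv ℝ (gradient (ρ j)) x =
      fderiv ℝ (gradient f) x + ∑ k, a k • fderiv ℝ (gradient (σ k)) x := by rw [hD]; abel
  rw [h6, traceOn_add, htf, traceOn_sum]
  simp [traceOn_smul, hσ0]

/-- The orthonormal system comes with its own number of functions; comparing dimensions of the
normal space identifies it with the codimension. -/
theorem IsMinimalSubmanifold.exists_isOrthonormalSystem {m : ℕ} (hM : IsMinimalSubmanifold m M)
    (hx : x ∈ M) : ∃ (p : ℕ) (U : Set (Euc n)) (ρ : Fin p → Euc n → ℝ), m + p = n ∧ x ∈ U ∧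
      IsOrthonormalSystem M U ρ := by
  obtain ⟨p, U, ρ, hxU, hρ, ho, -⟩ := hM.meanCurvature_eq_zero x hx
  obtain ⟨q, V, σ, hq, hxV, hσ⟩ := hM.smooth x hx
  refine ⟨p, U, ρ, ?_, hxU, ⟨hρ, ho⟩⟩
  rw [← hρ.finrank_normalSpace ⟨hx, hxU⟩, hσ.finrank_normalSpace ⟨hx, hxV⟩, hq]

end NormalSpace

/-! ### Fields tangent to the level sets, and their Euclidean divergence. -/

section Divergence

variable {n p : ℕ} {M U : Set (Euc n)} {ρ : Fin p → Euc n → ℝ} {x : Euc n}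

theorem IsDefiningSystem.contDiffAt_gradient (h : IsDefiningSystem M U ρ) (hx : x ∈ U)
    (j : Fin p) : ContDiffAt ℝ 1 (gradient (ρ j)) x :=
  ((h.contDiffAt hx j).of_le two_le_infty).gradient (by norm_num)

/-- `|∇ρₖ|²` is constantly `1` along `M`, so its tangential derivative is zero; symmetry of the
Hessian moves `τ` to the other slot. -/
theorem IsOrthonormalSystem.inner_fderiv_gradient_self (h : IsOrthonormalSystem M U ρ)
    (hx : x ∈ M ∩ U) (k : Fin p) {τ : Euc n} (hτ : τ ∈ (normalSpace M x)ᗮ) :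
    inner ℝ τ (fderiv ℝ (gradient (ρ k)) x (gradient (ρ k) x)) = 0 := by
  have hg := h.contDiffAt_gradient hx.2 k
  have hd := (hg.differentiableAt (by simp)).hasFDerivAt
  have hC : ContDiffAt ℝ 1 (fun y => inner ℝ (gradient (ρ k) y) (gradient (ρ k) y) - (1 : ℝ)) x :=
    (hg.inner ℝ hg).sub contDiffAt_const
  have h0 : ∀ᶠ y in 𝓝[M] x,
      inner ℝ (gradient (ρ k) y) (gradient (ρ k) y) - (1 : ℝ) = 0 := by
    filter_upwards [nhdsWithin_le_nhds (h.isOpen.mem_nhds hx.2), self_mem_nhdsWithin] with y hy hyM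
    rw [real_inner_self_eq_norm_sq, (h.orthonormal y ⟨hyM, hy⟩).1 k]
    norm_num
  have := inner_gradient_of_mem_orthogonal hC h0 hτ
  rw [((hd.inner ℝ hd).sub_const 1).fderiv] at this
  rw [← inner_fderiv_gradient_comm ((h.contDiffAt hx.2 k).of_le two_le_infty)]
  simp only [ContinuousLinearMap.comp_apply, ContinuousLinearMap.prod_apply,
    fderivInnerCLM_apply] at this
  rw [real_inner_comm] at this
  linarith

/-- The divergence of the projection of `W` to the level sets of the `ρⱼ`. -/
theorem IsOrthonormalSystem.trace_fderiv_sub_sum (h : IsOrthonormalSystem M U ρ)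
    (hx : x ∈ M ∩ U) {W : Euc n → Euc n} (hW : DifferentiableAt ℝ W x) {c : Fin p → Euc n → ℝ}
    (hc : ∀ j, DifferentiableAt ℝ (c j) x)
    (hcW : ∀ᶠ y in 𝓝 x, ∀ k,
      ∑ j, c j y * inner ℝ (gradient (ρ j) y) (gradient (ρ k) y) = inner ℝ (W y) (gradient (ρ k) y)) :
    LinearMap.trace ℝ (Euc n)
        (fderiv ℝ (fun y => W y - ∑ j, c j y • gradient (ρ j) y) x : Euc n →ₗ[ℝ] Euc n) =
      traceOn (normalSpace M x)ᗮ (fderiv ℝ W x) -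
        ∑ j, c j x * traceOn (normalSpace M x)ᗮ (fderiv ℝ (gradient (ρ j)) x) := by
  have ho := h.orthonormal x hx
  have hg (k) := ((h.contDiffAt_gradient hx.2 k).differentiableAt (by simp)).hasFDerivAt
  have hd : HasFDerivAt (fun y => W y - ∑ j, c j y • gradient (ρ j) y) _ x :=
    hW.hasFDerivAt.sub (HasFDerivAt.fun_sum (u := Finset.univ)
      fun j _ => (hc j).hasFDerivAt.smul (hg j))
  have hτ : W x - ∑ j, c j x • gradient (ρ j) x ∈ (normalSpace M x)ᗮ := by
    rw [← h.span_gradient_eq hx, Submodule.mem_orthogonal]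
    intro u hu
    induction hu using Submodule.span_induction with
    | mem u hu =>
      obtain ⟨k, rfl⟩ := hu
      have := hcW.self_of_nhds k
      rw [real_inner_comm, inner_sub_left, sum_inner, ← this]
      simp
    | zero => simp
    | add a b _ _ ha hb => rw [inner_add_left, ha, hb, add_zero]
    | smul c a _ ha => rw [inner_smul_left, ha, mul_zero]
  -- The Gram equation for `c` is differentiated in the direction `∇ρₖ`. The terms that
  -- differentiate the second factor `∇ρₖ` combine to the pairing of the tangential part of `W` with
  -- `D∇ρₖ(∇ρₖ)`, which is zero.
  have key (k) : fderiv ℝ (c k) x (gradient (ρ k) x) =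
      inner ℝ (gradient (ρ k) x) (fderiv ℝ W x (gradient (ρ k) x)) -
      ∑ j, c j x * inner ℝ (gradient (ρ k) x) (fderiv ℝ (gradient (ρ j)) x (gradient (ρ k) x)) := by
    have h1 : HasFDerivAt (fun y => ∑ j, c j y * inner ℝ (gradient (ρ j) y) (gradient (ρ k) y)) _ x :=
      HasFDerivAt.fun_sum (u := Finset.univ)
        fun j _ => (hc j).hasFDerivAt.mul ((hg j).inner ℝ (hg k))
    have h2 : HasFDerivAt (fun y => inner ℝ (W y) (gradient (ρ k) y)) _ x :=
      hW.hasFDerivAt.inner ℝ (hg k)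
    have h3 := h2.unique (h1.congr_of_eventuallyEq (hcW.mono fun y hy => (hy k).symm))
    have h4 := congrArg (fun L => L (gradient (ρ k) x)) h3
    have h5 := h.inner_fderiv_gradient_self hx k hτ
    have h6 (j) : inner ℝ (gradient (ρ j) x) (gradient (ρ k) x) = if j = k then (1 : ℝ) else 0 :=
      orthonormal_iff_ite.1 ho j k
    simp only [ContinuousLinearMap.comp_apply, ContinuousLinearMap.prod_apply,
      fderivInnerCLM_apply, _root_.sum_apply, _root_.add_apply,
      _root_.smul_apply, smul_eq_mul, h6, mul_add, Finset.sum_add_distrib, ite_mul,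
      one_mul, zero_mul, Finset.sum_ite_eq', Finset.mem_univ, if_true] at h4
    simp only [inner_sub_left, sum_inner, inner_smul_left, RCLike.conj_to_real] at h5
    have h7 (A : Euc n →L[ℝ] Euc n) : inner ℝ (gradient (ρ k) x) (A (gradient (ρ k) x)) =
      inner ℝ (A (gradient (ρ k) x)) (gradient (ρ k) x) := real_inner_comm _ _
    simp only [h7]
    linarith
  rw [hd.fderiv, ← h.span_gradient_eq hx, ho.traceOn_orthogonal_span]
  simp only [ho.traceOn_orthogonal_span]
  have e : ((fderiv ℝ W x - ∑ j, (c j x • fderiv ℝ (gradient (ρ j)) x +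
      (fderiv ℝ (c j) x).smulRight (gradient (ρ j) x)) : Euc n →L[ℝ] Euc n) : Euc n →ₗ[ℝ] Euc n) =
      (fderiv ℝ W x : Euc n →ₗ[ℝ] Euc n) -
      ∑ j, (c j x • (fderiv ℝ (gradient (ρ j)) x : Euc n →ₗ[ℝ] Euc n) +
      (fderiv ℝ (c j) x : Euc n →ₗ[ℝ] ℝ).smulRight (gradient (ρ j) x)) := by
    ext v; simp
  rw [e, map_sub, map_sum]
  simp only [map_add, map_smul, LinearMap.trace_smulRight, smul_eq_mul, mul_sub,
    Finset.sum_add_distrib, Finset.sum_sub_distrib, ContinuousLinearMap.coe_coe, key,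
    Finset.mul_sum]
  rw [Finset.sum_comm (f := fun k j => c j x * _)]
  ring

/-- Off `M` the gradients need not be orthonormal, so the projection requires solving a linear
system with their Gram matrix. That matrix is the identity at `x`, hence invertible on a
neighbourhood which does not depend on `W`. -/
theorem IsDefiningSystem.exists_projection_coefficients (h : IsDefiningSystem M U ρ)
    (hx : x ∈ U) (ho : Orthonormal ℝ fun j => gradient (ρ j) x) :
    ∃ V : Set (Euc n), IsOpen V ∧ x ∈ V ∧ V ⊆ U ∧ ∀ W : Euc n → Euc n, ContDiff ℝ 1 W →
      ∃ c : Fin p → Euc n → ℝ, (∀ j, ∀ y ∈ V, ContDiffAt ℝ 1 (c j) y) ∧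
        (∀ y ∈ V, ∀ k, ∑ j, c j y * inner ℝ (gradient (ρ j) y) (gradient (ρ k) y) =
          inner ℝ (W y) (gradient (ρ k) y)) ∧
        ∀ y, W y = 0 → ∀ j, c j y = 0 := by
  set G : Euc n → ((Fin p → ℝ) →L[ℝ] (Fin p → ℝ)) := fun y => ContinuousLinearMap.pi fun k =>
    ∑ j, (inner ℝ (gradient (ρ j) y) (gradient (ρ k) y) : ℝ) • ContinuousLinearMap.proj j with hG
  have hGapp (y) (v : Fin p → ℝ) (k) :
      G y v k = ∑ j, inner ℝ (gradient (ρ j) y) (gradient (ρ k) y) * v j := by simp [hG]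
  have hGC : ∀ y ∈ U, ContDiffAt ℝ 1 G y := by
    intro y hy
    refine ContDiffOn.contDiffAt (contDiffOn_clm_apply.2 fun v => contDiffOn_pi.2 fun k => ?_)
      (h.isOpen.mem_nhds hy)
    simp only [hGapp]
    exact fun z hz => (ContDiffAt.sum fun j _ => ((h.contDiffAt_gradient hz j).inner ℝ
      (h.contDiffAt_gradient hz k)).mul contDiffAt_const).contDiffWithinAt
  have hGx : G x = ((ContinuousLinearEquiv.refl ℝ (Fin p → ℝ)) : _ →L[ℝ] _) := by
    ext v k
    rw [hGapp]
    simp [orthonormal_iff_ite.1 ho]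
  have hopen := ContinuousLinearEquiv.isOpen (𝕜 := ℝ) (E := Fin p → ℝ) (F := Fin p → ℝ)
  refine ⟨U ∩ G ⁻¹' Set.range ((↑) : ((Fin p → ℝ) ≃L[ℝ] (Fin p → ℝ)) → _), ?_, ⟨hx, ?_⟩,
    Set.inter_subset_left, fun W hW => ?_⟩
  · exact ContinuousOn.isOpen_inter_preimage
      (fun y hy => (hGC y hy).continuousAt.continuousWithinAt) h.isOpen hopen
  · exact ⟨_, hGx.symm⟩
  · set b : Euc n → Fin p → ℝ := fun y k => inner ℝ (W y) (gradient (ρ k) y) with hb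
    refine ⟨fun j y => (G y).inverse (b y) j, fun j y hy => ?_, fun y hy k => ?_,
      fun y hy j => ?_⟩
    · obtain ⟨e, he⟩ := hy.2
      have h1 : ContDiffAt ℝ 1 (fun y => (G y).inverse) y :=
        ContDiffAt.comp y (g := ContinuousLinearMap.inverse) (he ▸ contDiffAt_map_inverse e)
          (hGC y hy.1)
      have h2 : ContDiffAt ℝ 1 b y := contDiffAt_pi.2 fun k =>
        hW.contDiffAt.inner ℝ (h.contDiffAt_gradient hy.1 k)
      exact contDiffAt_pi.1 (h1.clm_apply h2) j
    · obtain ⟨e, he⟩ := hy.2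
      have h1 : G y ((G y).inverse (b y)) = b y := by
        rw [← he, ContinuousLinearMap.inverse_equiv]; simp
      have h2 := congrFun h1 k
      rw [hGapp] at h2
      exact (Finset.sum_congr rfl fun j _ => mul_comm _ _).trans h2
    · have : b y = 0 := by ext k; simp [hb, hy]
      simp [this]

theorem integral_trace_fderiv_eq_zero {Y : Euc n → Euc n} (hY : ContDiff ℝ 1 Y)
    (hc : HasCompactSupport Y) :
    ∫ x, LinearMap.trace ℝ (Euc n) (fderiv ℝ Y x : Euc n →ₗ[ℝ] Euc n) = 0 := by
  have hint (v : Euc n) : Integrable (fun x => fderiv ℝ Y x v) :=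
    ((hY.continuous_fderiv (by simp)).clm_apply continuous_const).integrable_of_hasCompactSupport
      (hc.fderiv_apply (𝕜 := ℝ) v)
  have h0 (v : Euc n) : ∫ x, fderiv ℝ Y x v = 0 := by
    have := integral_smul_fderiv_eq_neg_fderiv_smul_of_integrable (μ := volume) (𝕜 := ℝ)
      (f := fun _ : Euc n => (1 : ℝ)) (g := Y) (v := v) (by simp) (by simpa using hint v)
      (by simpa using hY.continuous.integrable_of_hasCompactSupport hc)
      (fun x _ => by fun_prop) (fun x _ => hY.differentiable (by simp) x)
    simpa using this
  simp only [LinearMap.trace_eq_sum_inner _ (EuclideanSpace.basisFun (Fin n) ℝ),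
    ContinuousLinearMap.coe_coe]
  rw [integral_finsetSum _ fun i _ => (hint _).const_inner _]
  refine Finset.sum_eq_zero fun i _ => ?_
  rw [integral_inner (hint _), h0, inner_zero_right]

/-- The map `(ρ₁, …, ρₚ)`. -/
def jointMap (ρ : Fin p → Euc n → ℝ) (y : Euc n) : Euc p := WithLp.toLp 2 fun j => ρ j y

theorem IsDefiningSystem.contDiffAt_jointMap (h : IsDefiningSystem M U ρ) (hx : x ∈ U) :
    ContDiffAt ℝ ∞ (jointMap ρ) x :=
  contDiffAt_euclidean.2 fun j => h.contDiffAt hx j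

theorem IsDefiningSystem.fderiv_jointMap_apply (h : IsDefiningSystem M U ρ) (hx : x ∈ U)
    (v : Euc n) (j : Fin p) : fderiv ℝ (jointMap ρ) x v j = inner ℝ (gradient (ρ j) x) v := by
  rw [inner_gradient_left']
  have h1 := ((h.contDiffAt_jointMap hx).differentiableAt (by simp)).hasFDerivAt
  have h2 := ((EuclideanSpace.proj (𝕜 := ℝ) j).hasFDerivAt.comp x h1).fderiv
  rw [show (EuclideanSpace.proj (𝕜 := ℝ) j) ∘ jointMap ρ = ρ j from rfl] at h2
  rw [h2]; rfl

/-- Here `f` is the Euclidean divergence of the projection `Y` of `W`. The weight `χ(ρ)` may be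
arbitrary because `Y` is tangent to every level set near `x`, not only to `M`. -/
theorem IsOrthonormalSystem.exists_divergence (h : IsOrthonormalSystem M U ρ)
    (hmean : ∀ y ∈ M ∩ U, ∀ j, traceOn (normalSpace M y)ᗮ (fderiv ℝ (gradient (ρ j)) y) = 0)
    (hx : x ∈ M ∩ U) : ∃ V : Set (Euc n), IsOpen V ∧ x ∈ V ∧ V ⊆ U ∧
      ∀ W : Euc n → Euc n, ContDiff ℝ 1 W → HasCompactSupport W → tsupport W ⊆ V →
      ∃ f : Euc n → ℝ, Continuous f ∧ HasCompactSupport f ∧ tsupport f ⊆ V ∧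
        (∀ y ∈ M, f y = traceOn (normalSpace M y)ᗮ (fderiv ℝ W y)) ∧
        ∀ χ : Euc p → ℝ, ContDiff ℝ 1 χ → ∫ y, χ (jointMap ρ y) * f y = 0 := by
  obtain ⟨V, hV, hxV, hVU, hcoef⟩ :=
    h.exists_projection_coefficients hx.2 (h.orthonormal x hx)
  refine ⟨V, hV, hxV, hVU, fun W hW hWc hWV => ?_⟩
  obtain ⟨c, hcC, hcW, hc0⟩ := hcoef W hW
  set Y : Euc n → Euc n := fun y => W y - ∑ j, c j y • gradient (ρ j) y with hYdef
  have hYsupp : Function.support Y ⊆ Function.support W := by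
    intro y hy hWy
    exact hy (by simp [hYdef, hWy, hc0 y hWy])
  have hYts : tsupport Y ⊆ tsupport W := closure_mono hYsupp
  have hYC : ContDiff ℝ 1 Y := by
    refine contDiff_iff_contDiffAt.2 fun y => ?_
    by_cases hy : y ∈ V
    · exact hW.contDiffAt.sub (ContDiffAt.sum fun j _ =>
        (hcC j y hy).smul (h.contDiffAt_gradient (hVU hy) j))
    · have hy' : y ∉ tsupport Y := fun hh => hy (hWV (hYts hh))
      exact (contDiffAt_const (c := (0 : Euc n))).congr_of_eventuallyEq
        (notMem_tsupport_iff_eventuallyEq.1 hy')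
  have hYc : HasCompactSupport Y := hWc.mono hYsupp
  have hfsupp : Function.support (fun y => LinearMap.trace ℝ (Euc n)
      (fderiv ℝ Y y : Euc n →ₗ[ℝ] Euc n)) ⊆ Function.support (fderiv ℝ Y) := by
    intro y hy hy'
    exact hy (by simp [hy'])
  refine ⟨fun y => LinearMap.trace ℝ (Euc n) (fderiv ℝ Y y : Euc n →ₗ[ℝ] Euc n), ?_,
    (hYc.fderiv (𝕜 := ℝ)).mono hfsupp,
    ((closure_mono hfsupp).trans (tsupport_fderiv_subset ℝ)).trans (hYts.trans hWV),
    fun y hy => ?_, fun χ hχ => ?_⟩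
  · simp only [LinearMap.trace_eq_sum_inner _ (EuclideanSpace.basisFun (Fin n) ℝ),
      ContinuousLinearMap.coe_coe]
    have := hYC.continuous_fderiv (by simp)
    fun_prop
  · by_cases hyV : y ∈ V
    · have hyU : y ∈ M ∩ U := ⟨hy, hVU hyV⟩
      refine (h.trace_fderiv_sub_sum hyU (hW.differentiable (by simp) y)
        (fun j => (hcC j y hyV).differentiableAt (by simp))
        ((hV.eventually_mem hyV).mono hcW)).trans ?_
      simp [hmean y hyU]
    · have h1 : fderiv ℝ Y y = 0 := by
        have := mt (fun hh => hWV (hYts (tsupport_fderiv_subset ℝ hh))) hyV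
        exact image_eq_zero_of_notMem_tsupport this
      have h2 : fderiv ℝ W y = 0 := by
        have := mt (fun hh => hWV (tsupport_fderiv_subset ℝ hh)) hyV
        exact image_eq_zero_of_notMem_tsupport this
      simp [h1, h2, traceOn]
  · set Z : Euc n → Euc n := fun y => χ (jointMap ρ y) • Y y with hZ
    have hZsupp : Function.support Z ⊆ Function.support Y := by
      intro y hy hYy
      exact hy (by simp [hZ, hYy])
    have hR (y) (hy : y ∈ V) : ContDiffAt ℝ 1 (fun y => χ (jointMap ρ y)) y :=
      hχ.contDiffAt.comp y ((h.contDiffAt_jointMap (hVU hy)).of_le (by simp))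
    have hZC : ContDiff ℝ 1 Z := by
      refine contDiff_iff_contDiffAt.2 fun y => ?_
      by_cases hy : y ∈ V
      · exact (hR y hy).smul hYC.contDiffAt
      · have hy' : y ∉ tsupport Z := fun hh => hy (hWV (hYts (closure_mono hZsupp hh)))
        exact (contDiffAt_const (c := (0 : Euc n))).congr_of_eventuallyEq
          (notMem_tsupport_iff_eventuallyEq.1 hy')
    rw [← integral_trace_fderiv_eq_zero hZC (hYc.mono hZsupp)]
    congr 1 with y
    by_cases hyV : y ∈ V
    · have hd := ((hR y hyV).differentiableAt (by simp)).hasFDerivAt.smul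
        (hYC.differentiable (by simp) y).hasFDerivAt
      have hd' : HasFDerivAt Z _ y := hd
      rw [hd'.fderiv]
      -- Tangency of `Y` kills the term `⟨∇(χ ∘ ρ), Y⟩` in the product rule.
      have hker : fderiv ℝ (fun y => χ (jointMap ρ y)) y (Y y) = 0 := by
        have h1 := ((h.contDiffAt_jointMap (hVU hyV)).differentiableAt (by simp)).hasFDerivAt
        have h2 := ((hχ.differentiable (by simp) (jointMap ρ y)).hasFDerivAt.comp y h1).fderiv
        rw [show (fun y => χ (jointMap ρ y)) = χ ∘ jointMap ρ from rfl, h2]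
        have h3 : fderiv ℝ (jointMap ρ) y (Y y) = 0 := by
          ext k
          rw [h.fderiv_jointMap_apply (hVU hyV), real_inner_comm, hYdef, inner_sub_left, sum_inner,
            ← hcW y hyV k]
          simp
        simp [h3]
      have e : ((χ (jointMap ρ y) • fderiv ℝ Y y +
          (fderiv ℝ (fun y => χ (jointMap ρ y)) y).smulRight (Y y) : Euc n →L[ℝ] Euc n) :
          Euc n →ₗ[ℝ] Euc n) = χ (jointMap ρ y) • (fderiv ℝ Y y : Euc n →ₗ[ℝ] Euc n) +
          (fderiv ℝ (fun y => χ (jointMap ρ y)) y : Euc n →ₗ[ℝ] ℝ).smulRight (Y y) := by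
        ext v; simp
      rw [e, map_add, LinearMap.trace_smulRight]
      simp [hker]
    · have h1 : fderiv ℝ Y y = 0 := by
        have := mt (fun hh => hWV (hYts (tsupport_fderiv_subset ℝ hh))) hyV
        exact image_eq_zero_of_notMem_tsupport this
      have h2 : fderiv ℝ Z y = 0 := by
        have := mt (fun hh => hWV (hYts (closure_mono hZsupp
          (tsupport_fderiv_subset ℝ hh)))) hyV
        exact image_eq_zero_of_notMem_tsupport this
      simp [h1, h2]

end Divergence

open scoped NNReal ENNReal

/-! ### Almost isometric charts flattening `M`. -/

section Chart

variable {n m p : ℕ} {M U : Set (Euc n)} {ρ : Fin p → Euc n → ℝ} {x : Euc n}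

theorem Orthonormal.exists_isometry_prod {v : Fin p → Euc n} (hv : Orthonormal ℝ v)
    (hmp : m + p = n) : ∃ J : Euc n ≃ₗᵢ[ℝ] WithLp 2 (Euc m × Euc p),
      ∀ y k, (J y).snd k = inner ℝ (v k) y := by
  have hcard : Module.finrank ℝ (Euc n) = Fintype.card (Fin m ⊕ Fin p) := by simp [hmp]
  -- The zeros on `Fin m` are placeholders: only the vectors indexed by the range of `Sum.inr` are
  -- prescribed.
  obtain ⟨b, hb⟩ := Orthonormal.exists_orthonormalBasis_extension_of_card_eq (𝕜 := ℝ)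
    (v := Sum.elim (fun _ : Fin m => (0 : Euc n)) v) (s := Set.range Sum.inr) hcard (by
      rw [orthonormal_iff_ite]
      rintro ⟨_, i, rfl⟩ ⟨_, j, rfl⟩
      have := orthonormal_iff_ite.1 hv i j
      by_cases hij : i = j
      · simp_all
      · simp_all only [if_false]
        exact this.trans (if_neg fun h =>
          hij (Sum.inr_injective (congrArg Subtype.val h))).symm)
  refine ⟨b.repr.trans (PiLp.sumPiLpEquivProdLpPiLp 2 fun _ => ℝ), fun y k => ?_⟩
  have h1 : ((b.repr.trans (PiLp.sumPiLpEquivProdLpPiLp 2 fun _ => ℝ)) y).snd k =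
    b.repr y (Sum.inr k) := rfl
  rw [h1, b.repr_apply_apply, hb _ (Set.mem_range_self k)]
  rfl

theorem LipschitzOnWith.euclideanHausdorffMeasure_image_le {X Y : Type*} [MetricSpace X]
    [MeasurableSpace X] [BorelSpace X] [MetricSpace Y] [MeasurableSpace Y] [BorelSpace Y]
    {K : ℝ≥0} {f : X → Y} {s : Set X} (h : LipschitzOnWith K f s) (d : ℕ) :
    μHE[d] (f '' s) ≤ (K : ℝ≥0∞) ^ d * μHE[d] s := by
  rw [Measure.euclideanHausdorffMeasure_def, Measure.euclideanHausdorffMeasure_def]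
  have := h.hausdorffMeasure_image_le (d := d) (by positivity)
  rw [ENNReal.rpow_natCast] at this
  simp only [Measure.smul_apply, ENNReal.smul_def, smul_eq_mul]
  calc _ ≤ _ := mul_le_mul_right this _
    _ = _ := by ring

/-- A chart which flattens `M`, has `R` as its last component, and distorts measures by a factor
of at most `δ`. -/
structure IsFlatteningChart (M : Set (Euc n)) (R : Euc n → Euc p) (δ : ℝ≥0)
    (P : Euc n →L[ℝ] Euc m) (φ : OpenPartialHomeomorph (Euc n) (Euc m × Euc p)) : Prop where
  apply_eq : ∀ y, φ y = (P y, R y)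
  norm_le : ∀ y, ‖P y‖ ≤ ‖y‖
  mem_iff : ∀ y ∈ φ.source, y ∈ M ↔ R y = 0
  lipschitz : LipschitzOnWith δ (fun z => φ.symm (z, 0)) {z | (z, 0) ∈ φ.target}
  volume_image_le : ∀ B ⊆ φ.target, volume (φ.symm '' B) ≤ δ * volume B
  volume_le_image : ∀ B ⊆ φ.target, volume B ≤ δ * volume (φ.symm '' B)

/-- Both bounds express that a map close to the identity has Jacobian close to `1`. The condition `1
+ c ≤ δ` makes such a map `δ`-Lipschitz as well. -/
theorem exists_nnreal_bounds (n : ℕ) {δ : ℝ≥0} (hδ : 1 < δ) : ∃ c : ℝ≥0, 0 < c ∧ 1 + c ≤ δ ∧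
    ∀ (s : Set (Euc n)) (f : Euc n → Euc n),
      ApproximatesLinearOn f (ContinuousLinearMap.id ℝ (Euc n)) s c →
        volume (f '' s) ≤ δ * volume s ∧ volume s ≤ δ * volume (f '' s) := by
  have h1 := addHaar_image_le_mul_of_det_lt (volume : Measure (Euc n))
    (ContinuousLinearMap.id ℝ (Euc n)) (m := δ) (by simpa [ContinuousLinearMap.det] using hδ)
  have h2 := mul_le_addHaar_image_of_lt_det (volume : Measure (Euc n))
    (ContinuousLinearMap.id ℝ (Euc n)) (m := δ⁻¹)
    (by simpa [ContinuousLinearMap.det] using inv_lt_one_of_one_lt₀ hδ)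
  have h3 : ∀ᶠ c : ℝ≥0 in 𝓝[>] 0, c < δ - 1 :=
    nhdsWithin_le_nhds (gt_mem_nhds (tsub_pos_of_lt hδ))
  obtain ⟨c, ⟨⟨hc1, hc2⟩, hc3⟩, hc0⟩ :=
    (((h1.and h2).and h3).and self_mem_nhdsWithin).exists
  refine ⟨c, hc0, ?_, fun s f hf => ⟨hc1 s f hf, ?_⟩⟩
  · rw [add_comm]; exact (lt_tsub_iff_right.1 hc3).le
  · have h4 := hc2 s f hf
    have hδ0 : δ ≠ 0 := by positivity
    calc volume s = δ * ((δ⁻¹ : ℝ≥0) * volume s) := by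
          rw [← mul_assoc, ← ENNReal.coe_mul, mul_inv_cancel₀ hδ0]; simp
      _ ≤ _ := mul_le_mul_right h4 _

/-- Because the gradients are orthonormal at `x`, adding an orthogonal projection `P` to the tangent
space gives a map `(P, ρ)` whose derivative at `x` is an isometry up to the choice of product norm.
The inverse function theorem then gives distortion as close to `1` as desired near `x`. -/
theorem IsOrthonormalSystem.exists_isFlatteningChart (h : IsOrthonormalSystem M U ρ)
    (hmp : m + p = n) (hx : x ∈ M ∩ U) {δ : ℝ≥0} (hδ : 1 < δ) :
    ∃ (P : Euc n →L[ℝ] Euc m) (φ : OpenPartialHomeomorph (Euc n) (Euc m × Euc p)),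
      x ∈ φ.source ∧ φ.source ⊆ U ∧ IsFlatteningChart M (jointMap ρ) δ P φ := by
  obtain ⟨J, hJ⟩ := (h.orthonormal x hx).exists_isometry_prod hmp
  obtain ⟨c, hc0, hcδ, hc⟩ := exists_nnreal_bounds n hδ
  let e : Euc n ≃L[ℝ] Euc m × Euc p :=
    J.toContinuousLinearEquiv.trans (WithLp.prodContinuousLinearEquiv 2 ℝ (Euc m) (Euc p))
  have he (y) : e y = ((J y).fst, (J y).snd) := rfl
  let P : Euc n →L[ℝ] Euc m := (ContinuousLinearMap.fst ℝ _ _).comp (e : Euc n →L[ℝ] Euc m × Euc p)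
  have hnorm (y) : ‖y‖ ^ 2 = ‖(J y).fst‖ ^ 2 + ‖(J y).snd‖ ^ 2 := by
    rw [← WithLp.prod_norm_sq_eq_of_L2, J.norm_map]
  have hP1 (y) : ‖P y‖ ≤ ‖y‖ := by
    have : ‖P y‖ ^ 2 ≤ ‖y‖ ^ 2 := by
      rw [hnorm]; exact le_add_of_nonneg_right (by positivity)
    exact le_of_sq_le_sq this (norm_nonneg _)
  have he1 (y) : ‖e y‖ ≤ ‖y‖ := by
    rw [he, Prod.norm_def]
    refine max_le (hP1 y) ?_
    have : ‖(J y).snd‖ ^ 2 ≤ ‖y‖ ^ 2 := by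
      rw [hnorm]; exact le_add_of_nonneg_left (by positivity)
    exact le_of_sq_le_sq this (norm_nonneg _)
  have hemp : MeasurePreserving e volume volume :=
    (WithLp.volume_preserving_ofLp (Euc m) (Euc p)).comp J.measurePreserving
  have hstrict : HasStrictFDerivAt (fun y => (P y, jointMap ρ y))
      (e : Euc n →L[ℝ] Euc m × Euc p) x := by
    have h1 : HasStrictFDerivAt (jointMap ρ) (fderiv ℝ (jointMap ρ) x) x :=
      (h.contDiffAt_jointMap hx.2).hasStrictFDerivAt (by simp)
    have h2 : (e : Euc n →L[ℝ] Euc m × Euc p) = P.prod (fderiv ℝ (jointMap ρ) x) := by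
      ext1 v
      refine Prod.ext rfl ?_
      ext k
      change (J v).snd k = fderiv ℝ (jointMap ρ) x v k
      rw [h.fderiv_jointMap_apply hx.2, hJ]
    rw [h2]
    exact P.hasStrictFDerivAt.prodMk h1
  set φ₀ := hstrict.toOpenPartialHomeomorph _ with hφ₀
  have hxφ₀ : x ∈ φ₀.source := hstrict.mem_toOpenPartialHomeomorph_source
  obtain ⟨s, hs, happrox⟩ := hstrict.to_localInverse.approximates_deriv_on_nhds (c := c)
    (Or.inr hc0)
  obtain ⟨s', hs's, hs'o, hxs'⟩ := mem_nhds_iff.1 hs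
  have hopen : IsOpen (φ₀.source ∩ (U ∩ φ₀ ⁻¹' s')) := by
    have := (φ₀.isOpen_inter_preimage hs'o).inter h.isOpen
    rwa [Set.inter_assoc, Set.inter_comm _ U] at this
  set φ := φ₀.restrOpen _ hopen with hφ
  have hsource : φ.source = φ₀.source ∩ (U ∩ φ₀ ⁻¹' s') := by
    rw [hφ, OpenPartialHomeomorph.restrOpen_source]
    ext y; simp only [Set.mem_inter_iff]; tauto
  have hφapp (y) : φ y = (P y, jointMap ρ y) := rfl
  have htarget : φ.target ⊆ s := by
    intro w hw
    have h1 := φ.map_target hw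
    rw [hsource] at h1
    have h2 := h1.2.2
    have h3 : φ₀ (φ.symm w) = w := φ.right_inv hw
    rw [Set.mem_preimage, h3] at h2
    exact hs's h2
  have happ : ApproximatesLinearOn φ.symm (e.symm : Euc m × Euc p →L[ℝ] Euc n) φ.target c :=
    fun w hw w' hw' => happrox w (htarget hw) w' (htarget hw')
  -- `Euc m × Euc p` carries the sup norm, for which `e` is only norm-nonincreasing, but `e`
  -- preserves volume. Composing with `e` reduces the volume bounds to maps of `ℝⁿ` close to the
  -- identity.
  have hconj (B : Set (Euc m × Euc p)) (hB : B ⊆ φ.target) :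
      ApproximatesLinearOn (fun y => φ.symm (e y)) (ContinuousLinearMap.id ℝ (Euc n))
        (e ⁻¹' B) c := by
    intro y hy y' hy'
    have := happ (e y) (hB hy) (e y') (hB hy')
    rw [← map_sub] at this
    refine (le_of_eq_of_le ?_ this).trans ?_
    · simp
    · exact mul_le_mul_of_nonneg_left (he1 _) c.2
  have hvol (B : Set (Euc m × Euc p)) : volume (e ⁻¹' B) = volume B :=
    hemp.measure_preimage_emb e.toHomeomorph.measurableEmbedding B
  have himg (B : Set (Euc m × Euc p)) : (fun y => φ.symm (e y)) '' (e ⁻¹' B) = φ.symm '' B := by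
    rw [show (fun y => φ.symm (e y)) = φ.symm ∘ e from rfl, Set.image_comp,
      Set.image_preimage_eq _ e.surjective]
  refine ⟨P, φ, ?_, ?_, ⟨hφapp, hP1, fun y hy => ?_, ?_, fun B hB => ?_, fun B hB => ?_⟩⟩
  · rw [hsource]; exact ⟨hxφ₀, hx.2, hxs'⟩
  · rw [hsource]; exact fun y hy => hy.2.1
  · rw [hsource] at hy
    rw [h.mem_iff y hy.2.1]
    constructor
    · intro h0; ext k; exact h0 k
    · intro h0 k; exact congrArg (fun w : Euc p => w k) h0
  · refine LipschitzOnWith.of_dist_le_mul fun z hz z' hz' => ?_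
    have h1 := happ _ hz _ hz'
    have h2 : ‖e.symm ((z, 0) - (z', 0))‖ = ‖z - z'‖ := by
      have h3 : J.symm (WithLp.toLp 2 ((z, 0) - (z', 0))) = e.symm ((z, 0) - (z', 0)) := rfl
      rw [← h3, J.symm.norm_map, ← sq_eq_sq₀ (norm_nonneg _) (norm_nonneg _),
        WithLp.prod_norm_sq_eq_of_L2]
      simp
    have h4 : ‖((z, 0) : Euc m × Euc p) - (z', 0)‖ = ‖z - z'‖ := by
      simp [Prod.norm_def]
    rw [h4] at h1
    rw [dist_eq_norm, dist_eq_norm]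
    calc ‖φ.symm (z, 0) - φ.symm (z', 0)‖
        = ‖(φ.symm (z, 0) - φ.symm (z', 0) - e.symm ((z, 0) - (z', 0))) +
            e.symm ((z, 0) - (z', 0))‖ := by rw [sub_add_cancel]
      _ ≤ c * ‖z - z'‖ + ‖z - z'‖ := (norm_add_le _ _).trans (add_le_add h1 h2.le)
      _ = ((1 + c : ℝ≥0) : ℝ) * ‖z - z'‖ := by push_cast; ring
      _ ≤ δ * ‖z - z'‖ := mul_le_mul_of_nonneg_right (by exact_mod_cast hcδ) (norm_nonneg _)
  · rw [← himg, ← hvol]; exact (hc _ _ (hconj B hB)).1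
  · rw [← himg, ← hvol]; exact (hc _ _ (hconj B hB)).2

end Chart

/-! ### Comparing integrals over `M` and over tubes with integrals in a chart. -/

section FlatteningChart

variable {n m p : ℕ} {M U : Set (Euc n)} {R : Euc n → Euc p} {δ : ℝ≥0}
  {P : Euc n →L[ℝ] Euc m} {φ : OpenPartialHomeomorph (Euc n) (Euc m × Euc p)}

theorem OpenPartialHomeomorph.continuous_indicator_comp_symm {X Y : Type*} [TopologicalSpace X]
    [TopologicalSpace Y] [T2Space Y] (φ : OpenPartialHomeomorph X Y) {f : X → ℝ}
    (hf : Continuous f) (hc : HasCompactSupport f) (hs : tsupport f ⊆ φ.source) :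
    Continuous (φ.target.indicator (f ∘ φ.symm)) ∧
      HasCompactSupport (φ.target.indicator (f ∘ φ.symm)) := by
  have hK : IsCompact (φ '' tsupport f) :=
    hc.isCompact.image_of_continuousOn (φ.continuousOn.mono hs)
  have hzero : ∀ w, w ∉ φ '' tsupport f → φ.target.indicator (f ∘ φ.symm) w = 0 := by
    intro w hw
    by_cases hwt : w ∈ φ.target
    · rw [Set.indicator_of_mem hwt]
      exact image_eq_zero_of_notMem_tsupport (f := f) fun hh => hw ⟨_, hh, φ.right_inv hwt⟩
    · exact Set.indicator_of_notMem hwt _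
  refine ⟨continuous_iff_continuousAt.2 fun w => ?_, HasCompactSupport.intro hK hzero⟩
  by_cases hwt : w ∈ φ.target
  · have h1 : ContinuousAt (f ∘ φ.symm) w := hf.continuousAt.comp (φ.continuousAt_symm hwt)
    refine h1.congr ?_
    filter_upwards [φ.open_target.mem_nhds hwt] with y hy
    rw [Set.indicator_of_mem hy]
  · have hw : w ∉ φ '' tsupport f := by
      rintro ⟨y, hy, rfl⟩; exact hwt (φ.map_source (hs hy))
    refine (continuousAt_const (y := (0 : ℝ))).congr ?_
    filter_upwards [hK.isClosed.isOpen_compl.mem_nhds hw] with y hy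
    rw [hzero y hy]

theorem OpenPartialHomeomorph.source_inter_preimage_eq_image {X Y : Type*} [TopologicalSpace X]
    [TopologicalSpace Y] (φ : OpenPartialHomeomorph X Y) (B : Set Y) :
    φ.source ∩ φ ⁻¹' B = φ.symm '' (B ∩ φ.target) := by
  ext x
  constructor
  · rintro ⟨hx, hxB⟩
    exact ⟨φ x, ⟨hxB, φ.map_source hx⟩, φ.left_inv hx⟩
  · rintro ⟨w, ⟨hwB, hw⟩, rfl⟩
    exact ⟨φ.map_target hw, by rwa [Set.mem_preimage, φ.right_inv hw]⟩

theorem IsFlatteningChart.map_volume_bounds (h : IsFlatteningChart M R δ P φ) :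
    (volume.restrict φ.source).map φ ≤ δ • volume.restrict φ.target ∧
      volume.restrict φ.target ≤ δ • (volume.restrict φ.source).map φ := by
  have hae : AEMeasurable φ (volume.restrict φ.source) :=
    φ.continuousOn.aemeasurable φ.open_source.measurableSet
  have hmap (B : Set (Euc m × Euc p)) (hB : MeasurableSet B) :
      (volume.restrict φ.source).map φ B = volume (φ.symm '' (B ∩ φ.target)) := by
    rw [Measure.map_apply_of_aemeasurable hae hB,
      Measure.restrict_apply' φ.open_source.measurableSet, Set.inter_comm,
      φ.source_inter_preimage_eq_image]
  constructor
  · refine Measure.le_iff.2 fun B hB => ?_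
    rw [hmap B hB, Measure.smul_apply, Measure.restrict_apply hB]
    exact h.volume_image_le _ Set.inter_subset_right
  · refine Measure.le_iff.2 fun B hB => ?_
    rw [Measure.smul_apply, hmap B hB, Measure.restrict_apply hB]
    exact h.volume_le_image _ Set.inter_subset_right

theorem IsFlatteningChart.source_inter_preimage (h : IsFlatteningChart M R δ P φ)
    (A : Set (Euc m)) : P ⁻¹' A ∩ (M ∩ φ.source) =
      (fun z => φ.symm (z, 0)) '' (A ∩ {z | (z, 0) ∈ φ.target}) := by
  ext x
  constructor
  · rintro ⟨hxA, hxM, hx⟩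
    have h1 : φ x = (P x, 0) := by rw [h.apply_eq, (h.mem_iff x hx).1 hxM]
    have h2 : ((P x, 0) : Euc m × Euc p) ∈ φ.target := h1 ▸ φ.map_source hx
    exact ⟨P x, ⟨hxA, h2⟩, by simp only [← h1, φ.left_inv hx]⟩
  · rintro ⟨z, ⟨hzA, hz⟩, rfl⟩
    have h1 : φ (φ.symm (z, 0)) = (z, 0) := φ.right_inv hz
    rw [h.apply_eq, Prod.mk.injEq] at h1
    refine ⟨?_, (h.mem_iff _ (φ.map_target hz)).2 h1.2, φ.map_target hz⟩
    rwa [Set.mem_preimage, h1.1]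

theorem IsFlatteningChart.apply_symm (h : IsFlatteningChart M R δ P φ) {z : Euc m}
    (hz : (z, 0) ∈ φ.target) : P (φ.symm (z, 0)) = z := by
  have h1 : φ (φ.symm (z, 0)) = (z, 0) := φ.right_inv hz
  rw [h.apply_eq, Prod.mk.injEq] at h1
  exact h1.1

theorem IsFlatteningChart.euclideanHausdorffMeasure_le (h : IsFlatteningChart M R δ P φ)
    (A : Set (Euc m)) :
    μHE[m] (P ⁻¹' A ∩ (M ∩ φ.source)) ≤ δ ^ m * volume (A ∩ {z | (z, 0) ∈ φ.target}) := by
  rw [h.source_inter_preimage, ← EuclideanSpace.euclideanHausdorffMeasure_eq_volume]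
  exact (h.lipschitz.mono Set.inter_subset_right).euclideanHausdorffMeasure_image_le m

/-- No factor `δ` is lost: `P` is 1-Lipschitz and inverts the parametrization `z ↦ φ.symm (z, 0)`.
-/
theorem IsFlatteningChart.le_euclideanHausdorffMeasure (h : IsFlatteningChart M R δ P φ)
    (A : Set (Euc m)) :
    volume (A ∩ {z | (z, 0) ∈ φ.target}) ≤ μHE[m] (P ⁻¹' A ∩ (M ∩ φ.source)) := by
  rw [h.source_inter_preimage, ← EuclideanSpace.euclideanHausdorffMeasure_eq_volume]
  have hP : LipschitzOnWith 1 P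
      ((fun z => φ.symm (z, 0)) '' (A ∩ {z | (z, 0) ∈ φ.target})) :=
    LipschitzOnWith.of_dist_le_mul fun x _ y _ => by
      rw [dist_eq_norm, dist_eq_norm, ← map_sub, NNReal.coe_one, one_mul]
      exact h.norm_le _
  have h1 := hP.euclideanHausdorffMeasure_image_le m
  have h2 : P '' ((fun z => φ.symm (z, 0)) '' (A ∩ {z | (z, 0) ∈ φ.target})) =
      A ∩ {z | (z, 0) ∈ φ.target} := by
    rw [Set.image_image]
    exact (Set.image_congr fun z hz => h.apply_symm hz.2).trans (Set.image_id' _)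
  rwa [h2, ENNReal.coe_one, one_pow, one_mul] at h1

theorem IsFlatteningChart.measurableSet (h : IsFlatteningChart M R δ P φ) :
    MeasurableSet (M ∩ φ.source) := by
  have h1 : IsOpen (φ.source ∩ φ ⁻¹' {w | w.2 ≠ 0}) :=
    φ.isOpen_inter_preimage (isOpen_ne_fun continuous_snd continuous_const)
  have h2 : M ∩ φ.source = φ.source \ (φ.source ∩ φ ⁻¹' {w | w.2 ≠ 0}) := by
    ext x
    simp only [Set.mem_inter_iff, Set.mem_sdiff, Set.mem_preimage, Set.mem_ofPred_eq, h.apply_eq]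
    constructor
    · rintro ⟨h1, h2⟩
      exact ⟨h2, fun h3 => h3.2 ((h.mem_iff x h2).1 h1)⟩
    · rintro ⟨h1, h2⟩
      refine ⟨(h.mem_iff x h1).2 ?_, h1⟩
      by_contra h3
      exact h2 ⟨h1, h3⟩
  rw [h2]
  exact φ.open_source.measurableSet.diff h1.measurableSet

theorem IsFlatteningChart.measure_inter_lt_top (h : IsFlatteningChart M R δ P φ) {K : Set (Euc n)}
    (hK : IsCompact K) (hKs : K ⊆ φ.source) : μHE[m] (M ∩ K) < ⊤ := by
  have h1 : M ∩ K ⊆ P ⁻¹' (P '' K) ∩ (M ∩ φ.source) :=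
    fun x hx => ⟨Set.mem_image_of_mem _ hx.2, hx.1, hKs hx.2⟩
  refine (measure_mono h1).trans_lt ((h.euclideanHausdorffMeasure_le _).trans_lt ?_)
  refine ENNReal.mul_lt_top (by finiteness) ((measure_mono Set.inter_subset_left).trans_lt ?_)
  exact (hK.image P.continuous).measure_lt_top

theorem IsFlatteningChart.integral_bounds (h : IsFlatteningChart M R δ P φ) {f : Euc n → ℝ}
    (hM : MeasurableSet M) (hf : Continuous f) (hc : HasCompactSupport f)
    (hs : tsupport f ⊆ φ.source) (hf0 : ∀ x, 0 ≤ f x) :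
    ∫ z, φ.target.indicator (f ∘ φ.symm) (z, 0) ≤ ∫ x in M, f x ∂μHE[m] ∧
      ∫ x in M, f x ∂μHE[m] ≤ δ ^ m * ∫ z, φ.target.indicator (f ∘ φ.symm) (z, 0) := by
  set F := φ.target.indicator (f ∘ φ.symm) with hF
  obtain ⟨hFc, hFs⟩ := φ.continuous_indicator_comp_symm hf hc hs
  set O : Set (Euc m) := {z | (z, 0) ∈ φ.target} with hO
  have hOo : IsOpen O := φ.open_target.preimage (by fun_prop : Continuous fun z : Euc m => (z, (0 : Euc p)))
  set g : Euc m → ℝ := fun z => F (z, 0) with hg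
  have hgc : Continuous g := hFc.comp (by fun_prop)
  have hgs : HasCompactSupport g :=
    HasCompactSupport.intro (hFs.isCompact.image continuous_fst) fun z hz =>
      image_eq_zero_of_notMem_tsupport (f := F) fun hh => hz ⟨(z, 0), hh, rfl⟩
  have hg0 : ∀ z, 0 ≤ g z := fun z => Set.indicator_nonneg (fun _ _ => hf0 _) _
  have hgint : Integrable g := hgc.integrable_of_hasCompactSupport hgs
  -- `κ` is the measure of `M` seen in the chart; it lies between Lebesgue measure on `O` and `δ ^
  -- m` times it.
  set κ := (μHE[m].restrict (M ∩ φ.source)).map P with hκ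
  have hκapp (A : Set (Euc m)) (hA : MeasurableSet A) :
      κ A = μHE[m] (P ⁻¹' A ∩ (M ∩ φ.source)) := by
    rw [hκ, Measure.map_apply P.continuous.measurable hA,
      Measure.restrict_apply (P.continuous.measurable hA)]
  have hκ1 : κ ≤ (δ ^ m) • volume.restrict O := by
    refine Measure.le_iff.2 fun A hA => ?_
    rw [hκapp A hA, Measure.smul_apply, Measure.restrict_apply hA]
    exact_mod_cast h.euclideanHausdorffMeasure_le A
  have hκ2 : volume.restrict O ≤ κ := by
    refine Measure.le_iff.2 fun A hA => ?_
    rw [hκapp A hA, Measure.restrict_apply hA]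
    exact h.le_euclideanHausdorffMeasure A
  have hgO : ∫ z in O, g z = ∫ z, g z :=
    setIntegral_eq_integral_of_forall_compl_eq_zero fun z hz =>
      Set.indicator_of_notMem (s := φ.target) hz _
  have hgκ : Integrable g κ :=
    (hgint.restrict.smul_measure_nnreal (c := δ ^ m)).mono_measure hκ1
  have hS : ∫ x in M, f x ∂μHE[m] = ∫ z, g z ∂κ := by
    rw [hκ, integral_map P.continuous.aemeasurable hgc.aestronglyMeasurable]
    rw [setIntegral_eq_of_subset_of_forall_sdiff_eq_zero hM
      (Set.inter_subset_left : M ∩ φ.source ⊆ M)]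
    · refine setIntegral_congr_fun h.measurableSet fun x hx => ?_
      have h1 : φ x = (P x, 0) := by rw [h.apply_eq, (h.mem_iff x hx.2).1 hx.1]
      have h2 : (P x, 0) ∈ φ.target := h1 ▸ φ.map_source hx.2
      simp only [hg, hF, Set.indicator_of_mem h2, Function.comp_apply, ← h1, φ.left_inv hx.2]
    · exact fun x hx => image_eq_zero_of_notMem_tsupport fun hh => hx.2 ⟨hx.1, hs hh⟩
  rw [hS, ← hgO]
  constructor
  · exact integral_mono_measure hκ2 (Eventually.of_forall hg0) hgκ
  · refine (integral_mono_measure hκ1 (Eventually.of_forall hg0)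
      (hgint.restrict.smul_measure_nnreal (c := δ ^ m))).trans_eq ?_
    rw [integral_smul_nnreal_measure]
    simp [NNReal.smul_def]

theorem IsFlatteningChart.tube_bounds (h : IsFlatteningChart M R δ P φ) {f : Euc n → ℝ}
    (hf : Continuous f) (hc : HasCompactSupport f)
    (hs : tsupport f ⊆ φ.source) (hf0 : ∀ x, 0 ≤ f x) {χ : Euc p → ℝ} (hχ : Continuous χ)
    (hχ0 : ∀ y, 0 ≤ χ y) :
    ∫ x, χ (R x) * f x ≤ δ * ∫ w : Euc m × Euc p, χ w.2 * φ.target.indicator (f ∘ φ.symm) w ∧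
      ∫ w : Euc m × Euc p, χ w.2 * φ.target.indicator (f ∘ φ.symm) w ≤
        δ * ∫ x, χ (R x) * f x := by
  set F := φ.target.indicator (f ∘ φ.symm) with hF
  obtain ⟨hFc, hFs⟩ := φ.continuous_indicator_comp_symm hf hc hs
  set g : Euc m × Euc p → ℝ := fun w => χ w.2 * F w with hg
  have hgc : Continuous g := (hχ.comp continuous_snd).mul hFc
  have hgs : HasCompactSupport g := hFs.mul_left
  have hg0 : ∀ z, 0 ≤ g z := fun z =>
    mul_nonneg (hχ0 _) (Set.indicator_nonneg (fun _ _ => hf0 _) _)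
  have hgint : Integrable g := hgc.integrable_of_hasCompactSupport hgs
  have hgO : ∫ w in φ.target, g w = ∫ w, g w :=
    setIntegral_eq_integral_of_forall_compl_eq_zero fun z hz => by
      simp only [hg, hF, Set.indicator_of_notMem hz, mul_zero]
  obtain ⟨h1, h2⟩ := h.map_volume_bounds
  have hae : AEMeasurable φ (volume.restrict φ.source) :=
    φ.continuousOn.aemeasurable φ.open_source.measurableSet
  have hS : ∫ x, χ (R x) * f x = ∫ w, g w ∂((volume.restrict φ.source).map φ) := by
    rw [integral_map hae hgc.aestronglyMeasurable,
      ← setIntegral_eq_integral_of_forall_compl_eq_zero (s := φ.source)]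
    · refine setIntegral_congr_fun φ.open_source.measurableSet fun x hx => ?_
      simp only [hg, hF, Set.indicator_of_mem (φ.map_source hx), Function.comp_apply,
        φ.left_inv hx]
      rw [h.apply_eq]
    · intro x hx
      rw [image_eq_zero_of_notMem_tsupport fun hh => hx (hs hh), mul_zero]
  have hi1 : Integrable g (δ • volume.restrict φ.target) := hgint.restrict.smul_measure_nnreal
  have hi2 : Integrable g ((volume.restrict φ.source).map φ) := hi1.mono_measure h1
  rw [hS, ← hgO]
  constructor
  · refine (integral_mono_measure h1 (Eventually.of_forall hg0) hi1).trans_eq ?_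
    rw [integral_smul_nnreal_measure]
    simp [NNReal.smul_def]
  · refine (integral_mono_measure h2 (Eventually.of_forall hg0)
      hi2.smul_measure_nnreal).trans_eq ?_
    rw [integral_smul_nnreal_measure]
    simp [NNReal.smul_def]

end FlatteningChart

/-! ### Finite smooth partitions of unity on a compact set. -/

section Partition

theorem IsCompact.exists_finite_smooth_partition {n : ℕ} {K : Set (Euc n)} (hK : IsCompact K)
    {S : Set (Euc n) → Prop} (hS : ∀ x ∈ K, ∃ V, IsOpen V ∧ x ∈ V ∧ S V) :
    ∃ (t : Finset (Euc n)) (χ : t → Euc n → ℝ), (∀ i, ContDiff ℝ ∞ (χ i)) ∧ (∀ i x, 0 ≤ χ i x) ∧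
      (∀ i, ∃ V, S V ∧ tsupport (χ i) ⊆ V) ∧ ∀ x ∈ K, ∑ i, χ i x = 1 := by
  choose! V hVo hxV hV using hS
  obtain ⟨t, htK, ht⟩ := hK.elim_nhds_subcover V fun x hx => (hVo x hx).mem_nhds (hxV x hx)
  obtain ⟨f, hf⟩ := SmoothPartitionOfUnity.exists_isSubordinate (modelWithCornersSelf ℝ (Euc n))
    hK.isClosed (fun i : t => V i) (fun i => hVo i (htK i i.2)) (by
      refine ht.trans fun x hx => ?_
      simp only [Set.mem_iUnion] at hx ⊢
      obtain ⟨i, hi, hx⟩ := hx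
      exact ⟨⟨i, hi⟩, hx⟩)
  refine ⟨t, fun i => f i, fun i => (f i).contMDiff.contDiff, fun i x => f.nonneg i x,
    fun i => ⟨V i, hV i (htK i i.2), hf i⟩, fun x hx => ?_⟩
  rw [← finsum_eq_sum_of_fintype]
  exact f.sum_eq_one hx

end Partition

/-! ### Averages over thin tubes converge to the integral over `M`. -/

section Tube

variable {n m p : ℕ} {M U : Set (Euc n)} {ρ : Fin p → Euc n → ℝ}

/-- A sequence of bump functions which concentrates at the origin. -/
noncomputable def tubeBump (p k : ℕ) : ContDiffBump (0 : Euc p) :=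
  ⟨1 / (k + 2), 1 / (k + 1), by positivity, one_div_lt_one_div_of_lt (by positivity) (by linarith)⟩

theorem tendsto_rOut_tubeBump (p : ℕ) : Tendsto (fun k => (tubeBump p k).rOut) atTop (𝓝 0) :=
  tendsto_one_div_add_atTop_nhds_zero_nat

/-- The average of `f` over thin tubes around the common zero set of the `ρⱼ`. -/
noncomputable def tubeIntegral (ρ : Fin p → Euc n → ℝ) (k : ℕ) (f : Euc n → ℝ) : ℝ :=
  ∫ x, (tubeBump p k).normed volume (jointMap ρ x) * f x

theorem IsDefiningSystem.continuousOn_jointMap (h : IsDefiningSystem M U ρ) :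
    ContinuousOn (jointMap ρ) U :=
  fun _ hx => (h.contDiffAt_jointMap hx).continuousAt.continuousWithinAt

theorem IsDefiningSystem.mem_iff_jointMap (h : IsDefiningSystem M U ρ) {y : Euc n} (hy : y ∈ U) :
    y ∈ M ↔ jointMap ρ y = 0 := by
  rw [h.mem_iff y hy]
  constructor
  · intro h0; ext k; exact h0 k
  · intro h0 k; exact congrArg (fun w : Euc p => w k) h0

theorem IsDefiningSystem.integrable_mul (h : IsDefiningSystem M U ρ) {f : Euc n → ℝ}
    (hf : Continuous f) (hc : HasCompactSupport f) (hs : tsupport f ⊆ U) {χ : Euc p → ℝ}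
    (hχ : Continuous χ) : Integrable fun x => χ (jointMap ρ x) * f x := by
  refine Continuous.integrable_of_hasCompactSupport (continuous_iff_continuousAt.2 fun x => ?_)
    hc.mul_left
  by_cases hx : x ∈ U
  · exact (hχ.continuousAt.comp (h.contDiffAt_jointMap hx).continuousAt).mul hf.continuousAt
  · refine (continuousAt_const (y := (0 : ℝ))).congr ?_
    filter_upwards [notMem_tsupport_iff_eventuallyEq.1 fun hh => hx (hs hh)] with y hy
    rw [hy]; simp

theorem IsDefiningSystem.tubeIntegral_sum (h : IsDefiningSystem M U ρ) {ι : Type*} (s : Finset ι)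
    {f : ι → Euc n → ℝ} (hf : ∀ i ∈ s, Continuous (f i)) (hc : ∀ i ∈ s, HasCompactSupport (f i))
    (hs : ∀ i ∈ s, tsupport (f i) ⊆ U) (k : ℕ) :
    tubeIntegral ρ k (fun x => ∑ i ∈ s, f i x) = ∑ i ∈ s, tubeIntegral ρ k (f i) := by
  simp only [tubeIntegral, Finset.mul_sum]
  exact integral_finsetSum _ fun i hi => h.integrable_mul (hf i hi) (hc i hi) (hs i hi)
    (ContDiffBump.continuous_normed _)

theorem continuous_integral_fst {F : Euc m × Euc p → ℝ} (hF : Continuous F)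
    (hc : HasCompactSupport F) : Continuous fun y => ∫ z, F (z, y) := by
  have hK := hc.isCompact.image continuous_fst
  have h1 : (fun y => ∫ z, F (z, y)) = fun y => ∫ z in Prod.fst '' tsupport F, F (z, y) := by
    ext y
    refine (setIntegral_eq_integral_of_forall_compl_eq_zero fun z hz => ?_).symm
    exact image_eq_zero_of_notMem_tsupport fun hh => hz ⟨_, hh, rfl⟩
  rw [h1]
  exact continuous_parametric_integral_of_continuous (f := fun y z => F (z, y))
    (hF.comp continuous_swap) hK

/-- By Fubini the integral is the convolution of the bump with the fibre integrals of `F`, evaluated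
at `0`; the sign in `g` undoes the reflection in the convolution. -/
theorem tendsto_integral_tubeBump {F : Euc m × Euc p → ℝ} (hF : Continuous F)
    (hc : HasCompactSupport F) :
    Tendsto (fun k => ∫ w : Euc m × Euc p, (tubeBump p k).normed volume w.2 * F w) atTop
      (𝓝 (∫ z, F (z, 0))) := by
  set g : Euc p → ℝ := fun y => ∫ z, F (z, -y) with hg
  have hgc : Continuous g := (continuous_integral_fst hF hc).comp continuous_neg
  have h1 := ContDiffBump.convolution_tendsto_right_of_continuous (μ := volume)
    (tendsto_rOut_tubeBump p) hgc 0
  have h2 : g 0 = ∫ z, F (z, 0) := by simp [hg]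
  rw [h2] at h1
  refine h1.congr fun k => ?_
  rw [convolution_def, Measure.volume_eq_prod, integral_prod_symm]
  · refine integral_congr_ae (Eventually.of_forall fun y => ?_)
    simp only [ContinuousLinearMap.lsmul_apply, hg, zero_sub, neg_neg, smul_eq_mul,
      integral_const_mul]
  · rw [← Measure.volume_eq_prod]
    exact (((ContDiffBump.continuous_normed _).comp continuous_snd).mul
      hF).integrable_of_hasCompactSupport hc.mul_left

/-- `S` is the limit of the tube averages of `f`, up to factors controlled by `δ`. -/
def IsTubeLimitUpTo (ρ : Fin p → Euc n → ℝ) (f : Euc n → ℝ) (S a b : ℝ) : Prop :=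
  ∃ (L : ℕ → ℝ) (I : ℝ), Tendsto L atTop (𝓝 I) ∧
    (∀ᶠ k in atTop, tubeIntegral ρ k f ≤ a * L k ∧ L k ≤ a * tubeIntegral ρ k f) ∧
    I ≤ S ∧ S ≤ b * I

theorem IsFlatteningChart.isTubeLimitUpTo {δ : ℝ≥0} {P : Euc n →L[ℝ] Euc m}
    {φ : OpenPartialHomeomorph (Euc n) (Euc m × Euc p)}
    (h : IsFlatteningChart M (jointMap ρ) δ P φ) (hM : MeasurableSet M) {f : Euc n → ℝ}
    (hf : Continuous f) (hc : HasCompactSupport f) (hs : tsupport f ⊆ φ.source)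
    (hf0 : ∀ x, 0 ≤ f x) : IsTubeLimitUpTo ρ f (∫ x in M, f x ∂μHE[m]) δ (δ ^ m) := by
  obtain ⟨hFc, hFs⟩ := φ.continuous_indicator_comp_symm hf hc hs
  obtain ⟨h1, h2⟩ := h.integral_bounds hM hf hc hs hf0
  exact ⟨_, _, tendsto_integral_tubeBump hFc hFs, Eventually.of_forall fun k =>
    h.tube_bounds hf hc hs hf0 (ContDiffBump.continuous_normed _) (ContDiffBump.nonneg_normed _),
    h1, h2⟩

/-- On the compact support of `f` the map `ρ` stays away from `0`, so thin tubes miss it altogether.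
-/
theorem IsDefiningSystem.isTubeLimitUpTo_of_forall_notMem (h : IsDefiningSystem M U ρ)
    {f : Euc n → ℝ} (hc : HasCompactSupport f) (hs : tsupport f ⊆ U) (hd : ∀ x ∈ tsupport f, x ∉ M)
    (a b : ℝ) : IsTubeLimitUpTo ρ f (∫ x in M, f x ∂μHE[m]) a b := by
  have hS : ∫ x in M, f x ∂μHE[m] = 0 :=
    setIntegral_eq_zero_of_forall_eq_zero fun x hx =>
      image_eq_zero_of_notMem_tsupport fun hh => hd x hh hx
  have hK : IsCompact (jointMap ρ '' tsupport f) :=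
    hc.isCompact.image_of_continuousOn (h.continuousOn_jointMap.mono hs)
  have h0 : (0 : Euc p) ∉ jointMap ρ '' tsupport f := by
    rintro ⟨x, hx, hx0⟩
    exact hd x hx ((h.mem_iff_jointMap (hs hx)).2 hx0)
  obtain ⟨ε, hε, hball⟩ := Metric.isOpen_iff.1 hK.isClosed.isOpen_compl 0 h0
  refine ⟨fun _ => 0, 0, tendsto_const_nhds, ?_, by simp [hS], by simp [hS]⟩
  filter_upwards [(tendsto_rOut_tubeBump p).eventually (gt_mem_nhds hε)] with k hk
  have hT : tubeIntegral ρ k f = 0 := by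
    refine integral_eq_zero_of_ae (Eventually.of_forall fun x => ?_)
    by_cases hx : x ∈ tsupport f
    · have h1 : jointMap ρ x ∉ Metric.ball (0 : Euc p) ε := fun hh =>
        hball hh (Set.mem_image_of_mem _ hx)
      have h2 : (tubeBump p k).normed volume (jointMap ρ x) = 0 := by
        rw [← Function.notMem_support, ContDiffBump.support_normed_eq]
        exact fun hh => h1 (Metric.ball_subset_ball hk.le hh)
      simp [h2]
    · simp [image_eq_zero_of_notMem_tsupport hx]
  simp [hT]

theorem IsOrthonormalSystem.exists_good_nhds (h : IsOrthonormalSystem M U ρ) (hmp : m + p = n)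
    {δ : ℝ≥0} (hδ : 1 < δ) {x : Euc n} (hx : x ∈ U) :
    ∃ V, IsOpen V ∧ x ∈ V ∧ V ⊆ U ∧ ((∀ y ∈ V, y ∉ M) ∨
      ∃ (P : Euc n →L[ℝ] Euc m) (φ : OpenPartialHomeomorph (Euc n) (Euc m × Euc p)),
        φ.source = V ∧ IsFlatteningChart M (jointMap ρ) δ P φ) := by
  by_cases hxM : x ∈ M
  · obtain ⟨P, φ, hxφ, hφU, hφ⟩ := h.exists_isFlatteningChart hmp ⟨hxM, hx⟩ hδ
    exact ⟨φ.source, φ.open_source, hxφ, hφU, Or.inr ⟨P, φ, rfl, hφ⟩⟩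
  · refine ⟨U ∩ jointMap ρ ⁻¹' {0}ᶜ,
      h.continuousOn_jointMap.isOpen_inter_preimage h.isOpen isOpen_compl_singleton,
      ⟨hx, fun h0 => hxM ((h.mem_iff_jointMap hx).2 h0)⟩, Set.inter_subset_left, Or.inl ?_⟩
    exact fun y hy hyM => hy.2 ((h.mem_iff_jointMap hy.1).1 hyM)

theorem IsOrthonormalSystem.measure_inter_lt_top (h : IsOrthonormalSystem M U ρ) (hmp : m + p = n)
    (hM : MeasurableSet M) {K : Set (Euc n)} (hK : IsCompact K) (hKU : K ⊆ U) :
    (μHE[m].restrict M) K < ⊤ := by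
  refine hK.measure_lt_top_of_nhdsWithin fun x hx => ?_
  obtain ⟨V, hVo, hxV, -, hV⟩ := h.exists_good_nhds hmp one_lt_two (hKU hx)
  obtain hV | ⟨P, φ, hφV, hφ⟩ := hV
  · refine ⟨V, nhdsWithin_le_nhds (hVo.mem_nhds hxV), ?_⟩
    rw [Measure.restrict_apply' hM, show V ∩ M = ∅ from
      Set.eq_empty_of_forall_notMem fun y hy => hV y hy.1 hy.2]
    simp
  · obtain ⟨C, hC, hxC, hCV⟩ := exists_compact_subset hVo hxV
    refine ⟨C, nhdsWithin_le_nhds (mem_interior_iff_mem_nhds.1 hxC), ?_⟩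
    rw [Measure.restrict_apply' hM, Set.inter_comm]
    exact hφ.measure_inter_lt_top hC (hφV ▸ hCV)

theorem Continuous.integrable_of_measure_tsupport_lt_top {f : Euc n → ℝ} (hf : Continuous f)
    (hc : HasCompactSupport f) {μ : Measure (Euc n)} (hμ : μ (tsupport f) < ⊤) :
    Integrable f μ := by
  obtain ⟨C, hC⟩ := hf.bounded_above_of_compact_support hc
  rw [← integrableOn_iff_integrable_of_support_subset (subset_tsupport f)]
  exact Measure.integrableOn_of_bounded hμ.ne hf.aestronglyMeasurable (M := C)
    (Eventually.of_forall hC)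

/-- The two-sided estimates add up, so a partition of unity reduces them to functions supported in
one flattening chart or away from `M`. -/
theorem IsOrthonormalSystem.isTubeLimitUpTo (h : IsOrthonormalSystem M U ρ) (hmp : m + p = n)
    (hM : MeasurableSet M) {f : Euc n → ℝ} (hf : Continuous f) (hc : HasCompactSupport f)
    (hs : tsupport f ⊆ U) (hf0 : ∀ x, 0 ≤ f x) {δ : ℝ≥0} (hδ : 1 < δ) :
    IsTubeLimitUpTo ρ f (∫ x in M, f x ∂μHE[m]) δ (δ ^ m) := by
  obtain ⟨t, χ, hχ, hχ0, hχV, hsum⟩ := hc.isCompact.exists_finite_smooth_partition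
    fun x hx => (h.exists_good_nhds hmp hδ (hs hx)).imp fun V hV => ⟨hV.1, hV.2.1, hV.2.2⟩
  have hfsum : f = fun x => ∑ i, χ i x * f x := by
    ext x
    by_cases hx : x ∈ tsupport f
    · rw [← Finset.sum_mul, hsum x hx, one_mul]
    · simp [image_eq_zero_of_notMem_tsupport hx]
  have hgc (i) : Continuous fun x => χ i x * f x := (hχ i).continuous.mul hf
  have hgs (i) : HasCompactSupport fun x => χ i x * f x := hc.mul_left
  have hgt (i) : tsupport (fun x => χ i x * f x) ⊆ tsupport f := tsupport_mul_subset_right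
  have hg (i) : IsTubeLimitUpTo ρ (fun x => χ i x * f x)
      (∫ x in M, χ i x * f x ∂μHE[m]) δ (δ ^ m) := by
    obtain ⟨V, ⟨hVU, hV⟩, hi⟩ := hχV i
    have hiV : tsupport (fun x => χ i x * f x) ⊆ V := tsupport_mul_subset_left.trans hi
    obtain hV | ⟨P, φ, hφV, hφ⟩ := hV
    · exact h.isTubeLimitUpTo_of_forall_notMem (hgs i) ((hgt i).trans hs)
        (fun x hx => hV x (hiV hx)) _ _
    · exact hφ.isTubeLimitUpTo hM (hgc i) (hgs i) (hφV ▸ hiV)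
        fun x => mul_nonneg (hχ0 i x) (hf0 x)
  choose L I hL hLk hI1 hI2 using hg
  have hT (k) : tubeIntegral ρ k f = ∑ i, tubeIntegral ρ k fun x => χ i x * f x := by
    conv_lhs => rw [hfsum]
    exact h.tubeIntegral_sum _ (fun i _ => hgc i) (fun i _ => hgs i)
      (fun i _ => (hgt i).trans hs) k
  have hS : ∫ x in M, f x ∂μHE[m] = ∑ i, ∫ x in M, χ i x * f x ∂μHE[m] := by
    conv_lhs => rw [hfsum]
    exact integral_finsetSum _ fun i _ => (hgc i).integrable_of_measure_tsupport_lt_top (hgs i)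
      (h.measure_inter_lt_top hmp hM (hgs i).isCompact ((hgt i).trans hs))
  refine ⟨fun k => ∑ i, L i k, ∑ i, I i, tendsto_finsetSum _ fun i _ => hL i, ?_, ?_, ?_⟩
  · filter_upwards [eventually_all.2 hLk] with k hk
    rw [hT, Finset.mul_sum, Finset.mul_sum]
    exact ⟨Finset.sum_le_sum fun i _ => (hk i).1, Finset.sum_le_sum fun i _ => (hk i).2⟩
  · rw [hS]; exact Finset.sum_le_sum fun i _ => hI1 i
  · rw [hS, Finset.mul_sum]; exact Finset.sum_le_sum fun i _ => hI2 i

/-- The charts depend on `δ`, but the tube integrals and the integral over `M` do not; letting `δ →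
1` squeezes the limit. -/
theorem IsOrthonormalSystem.tendsto_tubeIntegral_of_nonneg (h : IsOrthonormalSystem M U ρ)
    (hmp : m + p = n) (hM : MeasurableSet M) {f : Euc n → ℝ} (hf : Continuous f)
    (hc : HasCompactSupport f) (hs : tsupport f ⊆ U) (hf0 : ∀ x, 0 ≤ f x) :
    Tendsto (fun k => tubeIntegral ρ k f) atTop (𝓝 (∫ x in M, f x ∂μHE[m])) := by
  set S := ∫ x in M, f x ∂μHE[m] with hS
  have hδ : Tendsto (fun δ : ℝ≥0 => (δ : ℝ)) (𝓝[>] 1) (𝓝 1) :=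
    (NNReal.continuous_coe.tendsto 1).mono_left nhdsWithin_le_nhds
  rw [tendsto_order]
  constructor
  · intro a ha
    have h1 : Tendsto (fun δ : ℝ≥0 => (δ : ℝ)⁻¹ * (((δ : ℝ) ^ m)⁻¹ * S)) (𝓝[>] 1) (𝓝 S) := by
      have := (hδ.inv₀ one_ne_zero).mul (((hδ.pow m).inv₀ (by simp)).mul_const S)
      simpa using this
    obtain ⟨δ, hδa, hδ1⟩ := ((h1.eventually (lt_mem_nhds ha)).and self_mem_nhdsWithin).exists
    obtain ⟨L, I, hL, hLk, -, hI⟩ := h.isTubeLimitUpTo hmp hM hf hc hs hf0 hδ1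
    have hδ0 : (0 : ℝ) < δ := by
      have : (0 : ℝ≥0) < δ := zero_lt_one.trans hδ1
      exact_mod_cast this
    have h2 : a < (δ : ℝ)⁻¹ * I := by
      refine hδa.trans_le (mul_le_mul_of_nonneg_left ?_ (by positivity))
      rw [inv_mul_le_iff₀ (by positivity)]; exact hI
    filter_upwards [(hL.const_mul (δ : ℝ)⁻¹).eventually (lt_mem_nhds h2), hLk] with k hk1 hk2
    refine hk1.trans_le ?_
    rw [inv_mul_le_iff₀ hδ0]; exact hk2.2
  · intro b hb
    have h1 : Tendsto (fun δ : ℝ≥0 => (δ : ℝ) * S) (𝓝[>] 1) (𝓝 S) := by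
      simpa using hδ.mul_const S
    obtain ⟨δ, hδa, hδ1⟩ := ((h1.eventually (gt_mem_nhds hb)).and self_mem_nhdsWithin).exists
    obtain ⟨L, I, hL, hLk, hI, -⟩ := h.isTubeLimitUpTo hmp hM hf hc hs hf0 hδ1
    have h2 : (δ : ℝ) * I < b := (mul_le_mul_of_nonneg_left hI δ.2).trans_lt hδa
    filter_upwards [(hL.const_mul (δ : ℝ)).eventually (gt_mem_nhds h2), hLk] with k hk1 hk2
    exact hk2.1.trans_lt hk1

theorem IsOrthonormalSystem.tendsto_tubeIntegral (h : IsOrthonormalSystem M U ρ)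
    (hmp : m + p = n) (hM : MeasurableSet M) {f : Euc n → ℝ} (hf : Continuous f)
    (hc : HasCompactSupport f) (hs : tsupport f ⊆ U) :
    Tendsto (fun k => tubeIntegral ρ k f) atTop (𝓝 (∫ x in M, f x ∂μHE[m])) := by
  have hsupp (g : ℝ → ℝ) (hg : g 0 = 0) : Function.support (fun x => g (f x)) ⊆
      Function.support f := by
    intro x hx hfx; exact hx (by simp [hfx, hg])
  have hts (g : ℝ → ℝ) (hg : g 0 = 0) : tsupport (fun x => g (f x)) ⊆ U :=
    (closure_mono (hsupp g hg)).trans hs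
  have hp0 : max (0 : ℝ) 0 = 0 := max_self 0
  have hn0 : max (-(0 : ℝ)) 0 = 0 := by simp
  have hpc : Continuous fun x => max (f x) 0 := hf.max continuous_const
  have hnc : Continuous fun x => max (-f x) 0 := hf.neg.max continuous_const
  have hps : HasCompactSupport fun x => max (f x) 0 := hc.mono (hsupp (fun t => max t 0) hp0)
  have hns : HasCompactSupport fun x => max (-f x) 0 := hc.mono (hsupp (fun t => max (-t) 0) hn0)
  have hpU : tsupport (fun x => max (f x) 0) ⊆ U := hts (fun t => max t 0) hp0
  have hnU : tsupport (fun x => max (-f x) 0) ⊆ U := hts (fun t => max (-t) 0) hn0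
  have hfe (x) : f x = max (f x) 0 - max (-f x) 0 := by
    rcases le_total 0 (f x) with h0 | h0 <;> simp [h0]
  have h1 := (h.tendsto_tubeIntegral_of_nonneg hmp hM hpc hps hpU fun x => le_max_right _ _).sub
    (h.tendsto_tubeIntegral_of_nonneg hmp hM hnc hns hnU fun x => le_max_right _ _)
  have hS : ∫ x in M, f x ∂μHE[m] = ∫ x in M, max (f x) 0 ∂μHE[m] -
      ∫ x in M, max (-f x) 0 ∂μHE[m] := by
    rw [← integral_sub
      (hpc.integrable_of_measure_tsupport_lt_top hps
        (h.measure_inter_lt_top hmp hM hps.isCompact hpU))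
      (hnc.integrable_of_measure_tsupport_lt_top hns
        (h.measure_inter_lt_top hmp hM hns.isCompact hnU))]
    exact integral_congr_ae (Eventually.of_forall hfe)
  rw [hS]
  refine h1.congr fun k => ?_
  rw [tubeIntegral, tubeIntegral, ← integral_sub
    (h.integrable_mul hpc hps hpU (ContDiffBump.continuous_normed _))
    (h.integrable_mul hnc hns hnU (ContDiffBump.continuous_normed _))]
  refine integral_congr_ae (Eventually.of_forall fun x => ?_)
  simp only [← mul_sub, ← hfe]

end Tube

/-! ### The divergence theorem on a minimal submanifold. -/

section DivergenceTheorem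

variable {n m : ℕ} {M : Set (Euc n)}

/-- The divergence of the field `W` along `M`. -/
noncomputable def tangentialDivergence (M : Set (Euc n)) (W : Euc n → Euc n) (x : Euc n) : ℝ :=
  traceOn (normalSpace M x)ᗮ (fderiv ℝ W x)

theorem tangentialDivergence_eq_zero {W : Euc n → Euc n} {x : Euc n} (hx : x ∉ tsupport W) :
    tangentialDivergence M W x = 0 := by
  have : fderiv ℝ W x = 0 := image_eq_zero_of_notMem_tsupport
    fun hh => hx (tsupport_fderiv_subset ℝ hh)
  simp [tangentialDivergence, this, traceOn]

theorem measurableSet_of_closure_inter_subset {B : Set (Euc n)} (hB : IsOpen B) (hMB : M ⊆ B)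
    (hcl : closure M ∩ B ⊆ M) : MeasurableSet M := by
  rw [show M = closure M ∩ B from (Set.subset_inter subset_closure hMB).antisymm hcl]
  exact isClosed_closure.measurableSet.inter hB.measurableSet

theorem IsMinimalSubmanifold.measure_inter_lt_top (hM : IsMinimalSubmanifold m M)
    {B : Set (Euc n)} (hB : IsOpen B) (hMB : M ⊆ B) (hcl : closure M ∩ B ⊆ M) {K : Set (Euc n)}
    (hK : IsCompact K) (hKB : K ⊆ B) : μHE[m] (M ∩ K) < ⊤ := by
  have hMm := measurableSet_of_closure_inter_subset hB hMB hcl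
  rw [Set.inter_comm, ← Measure.restrict_apply' hMm]
  refine hK.measure_lt_top_of_nhdsWithin fun x hx => ?_
  by_cases hxM : x ∈ M
  · obtain ⟨p, U, ρ, hmp, hxU, hρ⟩ := hM.exists_isOrthonormalSystem hxM
    obtain ⟨C, hC, hxC, hCU⟩ := exists_compact_subset hρ.isOpen hxU
    exact ⟨C, nhdsWithin_le_nhds (mem_interior_iff_mem_nhds.1 hxC),
      hρ.measure_inter_lt_top hmp hMm hC hCU⟩
  · have hxc : x ∈ (closure M)ᶜ := fun hh => hxM (hcl ⟨hh, hKB hx⟩)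
    refine ⟨(closure M)ᶜ, nhdsWithin_le_nhds (isClosed_closure.isOpen_compl.mem_nhds hxc), ?_⟩
    rw [Measure.restrict_apply' hMm, show (closure M)ᶜ ∩ M = ∅ from
      Set.eq_empty_of_forall_notMem fun y hy => hy.1 (subset_closure hy.2)]
    simp

/-- Every tube integral of the divergence is zero, hence so is its limit, the integral over `M`. -/
theorem IsMinimalSubmanifold.exists_local_divergence_theorem (hM : IsMinimalSubmanifold m M)
    (hMm : MeasurableSet M) {x : Euc n} (hx : x ∈ M) :
    ∃ V, IsOpen V ∧ x ∈ V ∧ ∀ W : Euc n → Euc n, ContDiff ℝ 1 W → HasCompactSupport W →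
      tsupport W ⊆ V → IntegrableOn (tangentialDivergence M W) M μHE[m] ∧
        ∫ y in M, tangentialDivergence M W y ∂μHE[m] = 0 := by
  obtain ⟨p, U, ρ, hmp, hxU, hρ⟩ := hM.exists_isOrthonormalSystem hx
  obtain ⟨V, hV, hxV, hVU, hdiv⟩ := hρ.exists_divergence
    (fun y hy j => hρ.traceOn_fderiv_gradient_eq_zero hy (hM.meanCurvature_eq_zero y hy.1) j)
    ⟨hx, hxU⟩
  refine ⟨V, hV, hxV, fun W hW hWc hWV => ?_⟩
  obtain ⟨f, hf, hfc, hfV, hfM, hχ⟩ := hdiv W hW hWc hWV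
  have hlim := hρ.tendsto_tubeIntegral hmp hMm hf hfc (hfV.trans hVU)
  have h0 (k) : tubeIntegral ρ k f = 0 := hχ _ (ContDiffBump.contDiff_normed _)
  simp only [h0] at hlim
  have hint : IntegrableOn f M μHE[m] := hf.integrable_of_measure_tsupport_lt_top hfc
    (hρ.measure_inter_lt_top hmp hMm hfc.isCompact (hfV.trans hVU))
  refine ⟨hint.congr_fun hfM hMm, ?_⟩
  exact (setIntegral_congr_fun hMm hfM).symm.trans
    (tendsto_nhds_unique hlim tendsto_const_nhds)

theorem tangentialDivergence_sum {ι : Type*} (s : Finset ι) {W : ι → Euc n → Euc n}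
    (hW : ∀ i ∈ s, ContDiff ℝ 1 (W i)) (x : Euc n) :
    tangentialDivergence M (fun y => ∑ i ∈ s, W i y) x =
      ∑ i ∈ s, tangentialDivergence M (W i) x := by
  rw [tangentialDivergence, fderiv_fun_sum fun i hi => (hW i hi).differentiable (by simp) x,
    traceOn_sum]
  rfl

/-- The divergence theorem for fields with compact support along a minimal submanifold. -/
theorem IsMinimalSubmanifold.integral_tangentialDivergence_eq_zero
    (hM : IsMinimalSubmanifold m M) {B : Set (Euc n)} (hB : IsOpen B) (hMB : M ⊆ B)
    (hcl : closure M ∩ B ⊆ M) {W : Euc n → Euc n} (hW : ContDiff ℝ 1 W)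
    (hWc : HasCompactSupport W) (hWB : tsupport W ⊆ B) :
    IntegrableOn (tangentialDivergence M W) M μHE[m] ∧
      ∫ y in M, tangentialDivergence M W y ∂μHE[m] = 0 := by
  have hMm := measurableSet_of_closure_inter_subset hB hMB hcl
  obtain ⟨t, χ, hχ, -, hχV, hsum⟩ := hWc.isCompact.exists_finite_smooth_partition
    (S := fun V => ∀ W : Euc n → Euc n, ContDiff ℝ 1 W → HasCompactSupport W →
      tsupport W ⊆ V → IntegrableOn (tangentialDivergence M W) M μHE[m] ∧
        ∫ y in M, tangentialDivergence M W y ∂μHE[m] = 0) (fun x hx => by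
      by_cases hxM : x ∈ M
      · exact hM.exists_local_divergence_theorem hMm hxM
      -- A point of `B` outside `M` is not in the closure of `M`, and a field supported off that
      -- closure has zero divergence on `M`.
      · refine ⟨(closure M)ᶜ, isClosed_closure.isOpen_compl,
          fun hh => hxM (hcl ⟨hh, hWB hx⟩), fun Y _ _ hYV => ?_⟩
        have h0 : ∀ y ∈ M, tangentialDivergence M Y y = 0 := fun y hy =>
          tangentialDivergence_eq_zero fun hh => hYV hh (subset_closure hy)
        exact ⟨integrableOn_zero.congr_fun (fun y hy => (h0 y hy).symm) hMm,
          setIntegral_eq_zero_of_forall_eq_zero h0⟩)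
  obtain ⟨Y, hY⟩ : ∃ Y : t → Euc n → Euc n, ∀ i, Y i = χ i • W := ⟨_, fun _ => rfl⟩
  have hWsum : W = fun x => ∑ i, Y i x := by
    ext1 x
    by_cases hx : x ∈ tsupport W
    · simp only [hY, Pi.smul_apply', ← Finset.sum_smul, hsum x hx, one_smul]
    · simp [hY, image_eq_zero_of_notMem_tsupport hx]
  have hC (i) : ContDiff ℝ 1 (Y i) := hY i ▸ ((hχ i).of_le (by simp)).smul hW
  have hi (i) : IntegrableOn (tangentialDivergence M (Y i)) M μHE[m] ∧
      ∫ y in M, tangentialDivergence M (Y i) y ∂μHE[m] = 0 := by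
    obtain ⟨V, hV, hχiV⟩ := hχV i
    refine hV _ (hC i) ?_ ?_
    · rw [hY i]
      exact HasCompactSupport.smul_left (f := χ i) hWc
    · rw [hY i]
      exact (tsupport_smul_subset_left (χ i) W).trans hχiV
  have hdiv : tangentialDivergence M W = fun x => ∑ i, tangentialDivergence M (Y i) x := by
    ext1 x
    rw [← tangentialDivergence_sum _ (fun i _ => hC i) x, ← hWsum]
  rw [hdiv]
  refine ⟨integrable_finsetSum _ fun i _ => (hi i).1, ?_⟩
  rw [integral_finsetSum _ fun i _ => (hi i).1]
  exact Finset.sum_eq_zero fun i _ => (hi i).2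

end DivergenceTheorem

/-! ### The moving balls and the vector field adapted to them. -/

section MovingBalls

variable {n m : ℕ} {M : Set (Euc n)} {a x : Euc n} {s t : ℝ}

/-- On the unit sphere this is the squared distance to `a`. -/
noncomputable def poleWeight (a x : Euc n) : ℝ := 1 - 2 * inner ℝ a x + ‖a‖ ^ 2

/-- The function whose sublevel sets are balls growing from the point `a` to the unit ball. -/
noncomputable def poleRatio (a x : Euc n) : ℝ := ‖x - a‖ ^ 2 / poleWeight a x

/-- The balls growing from the point `a` to the unit ball. -/
def movingBall (a : Euc n) (s : ℝ) : Set (Euc n) := {x | ‖x - a‖ ^ 2 ≤ s * poleWeight a x}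

theorem poleWeight_eq (a x : Euc n) : poleWeight a x = ‖x - a‖ ^ 2 + (1 - ‖x‖ ^ 2) := by
  rw [poleWeight, norm_sub_sq_real, real_inner_comm]; ring

theorem poleWeight_self (a : Euc n) : poleWeight a a = 1 - ‖a‖ ^ 2 := by
  simp [poleWeight_eq]

theorem poleWeight_pos (hx : x ∈ Metric.ball (0 : Euc n) 1) : 0 < poleWeight a x := by
  rw [mem_ball_zero_iff] at hx
  rw [poleWeight_eq]
  have : ‖x‖ ^ 2 < 1 := by nlinarith [norm_nonneg x]
  have := sq_nonneg ‖x - a‖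
  linarith

theorem continuous_poleWeight (a : Euc n) : Continuous (poleWeight a) := by
  unfold poleWeight; fun_prop

theorem measurable_poleRatio (a : Euc n) : Measurable (poleRatio a) :=
  (by fun_prop : Continuous fun x : Euc n => ‖x - a‖ ^ 2).measurable.div
    (continuous_poleWeight a).measurable

theorem poleRatio_nonneg (hx : x ∈ Metric.ball (0 : Euc n) 1) : 0 ≤ poleRatio a x :=
  div_nonneg (sq_nonneg _) (poleWeight_pos hx).le

theorem mem_movingBall_iff (hx : x ∈ Metric.ball (0 : Euc n) 1) :
    x ∈ movingBall a s ↔ poleRatio a x ≤ s :=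
  (div_le_iff₀ (poleWeight_pos hx)).symm

/-- If `|x| ≥ 1` then the weight is at most `|x - a|²`, so membership gives `(1 - s)|x - a|² ≤ 0`
and `x = a`, which lies inside the unit ball. -/
theorem movingBall_subset_ball (ha : a ∈ Metric.ball (0 : Euc n) 1) (hs0 : 0 ≤ s) (hs1 : s < 1) :
    movingBall a s ⊆ Metric.ball 0 1 := by
  intro x hx
  have hx' : ‖x - a‖ ^ 2 ≤ s * poleWeight a x := hx
  rw [poleWeight_eq] at hx'
  rw [mem_ball_zero_iff] at ha ⊢
  by_contra! h1
  have h2 : 1 ≤ ‖x‖ ^ 2 := by nlinarith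
  have h3 : (1 - s) * ‖x - a‖ ^ 2 ≤ 0 := by nlinarith
  have h4 : ‖x - a‖ ^ 2 ≤ 0 := by
    by_contra! h5
    have := mul_pos (sub_pos.2 hs1) h5
    linarith
  have h5 : x - a = 0 := by
    rw [← norm_eq_zero]
    exact pow_eq_zero_iff two_ne_zero |>.1 (le_antisymm h4 (sq_nonneg _))
  rw [sub_eq_zero.1 h5] at h1
  linarith

theorem isCompact_movingBall (ha : a ∈ Metric.ball (0 : Euc n) 1) (hs0 : 0 ≤ s) (hs1 : s < 1) :
    IsCompact (movingBall a s) := by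
  refine Metric.isCompact_of_isClosed_isBounded ?_
    (Metric.isBounded_ball.subset (movingBall_subset_ball ha hs0 hs1))
  have h1 : Continuous fun x : Euc n => ‖x - a‖ ^ 2 := by fun_prop
  exact isClosed_le h1 (continuous_const.mul (continuous_poleWeight a))

theorem contDiffAt_poleRatio (hx : x ∈ Metric.ball (0 : Euc n) 1) :
    ContDiffAt ℝ ∞ (poleRatio a) x := by
  refine ContDiffAt.div ?_ ?_ (poleWeight_pos hx).ne'
  · exact ((contDiff_id.sub contDiff_const).norm_sq ℝ).contDiffAt
  · exact ((contDiff_const.sub (contDiff_const.mul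
      (contDiff_const.inner ℝ contDiff_id))).add contDiff_const).contDiffAt

theorem hasFDerivAt_poleRatio (hx : x ∈ Metric.ball (0 : Euc n) 1) :
    HasFDerivAt (poleRatio a)
      ((2 / poleWeight a x) • innerSL ℝ (x - a + poleRatio a x • a)) x := by
  have hl := (poleWeight_pos (a := a) hx).ne'
  have h1 : HasFDerivAt (fun x : Euc n => ‖x - a‖ ^ 2) (2 • innerSL ℝ (x - a)) x := by
    have := ((hasFDerivAt_id x).sub_const a).norm_sq
    simpa using this
  have h2 : HasFDerivAt (poleWeight a) (-(2 • innerSL ℝ a)) x := by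
    have := (((innerSL ℝ a).hasFDerivAt (x := x)).const_mul 2).const_sub 1 |>.add_const (‖a‖ ^ 2)
    refine this.congr_fderiv ?_
    ext v; simp
  have h3 : HasFDerivAt (poleRatio a) _ x :=
    (h1.mul ((hasDerivAt_inv hl).comp_hasFDerivAt x h2)).congr_of_eventuallyEq
      (Eventually.of_forall fun y => div_eq_mul_inv _ _)
  refine h3.congr_fderiv ?_
  ext v
  simp only [poleRatio, _root_.smul_apply, _root_.add_apply, Function.comp_apply, _root_.neg_apply, innerSL_apply_apply,
    smul_eq_mul, inner_add_left, inner_smul_left, RCLike.conj_to_real, nsmul_eq_mul]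
  field_simp
  push_cast
  ring

/-- A vector field adapted to the balls `movingBall a s`. -/
noncomputable def poleField (φ Φ : ℝ → ℝ) (a : Euc n) (t : ℝ) (x : Euc n) : Euc n :=
  open scoped Classical in
  if x ∈ Metric.ball (0 : Euc n) 1 then
    -(φ (poleRatio a x / t)) • (x - a) + (t * Φ (poleRatio a x / t)) • a
  else 0

theorem poleField_eventuallyEq (φ Φ : ℝ → ℝ) (hx : x ∈ Metric.ball (0 : Euc n) 1) :
    poleField φ Φ a t =ᶠ[𝓝 x] fun x =>
      -(φ (poleRatio a x / t)) • (x - a) + (t * Φ (poleRatio a x / t)) • a := by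
  filter_upwards [Metric.isOpen_ball.mem_nhds hx] with y hy
  rw [poleField, if_pos hy]

theorem tsupport_poleField_subset {φ Φ : ℝ → ℝ} (hφ1 : ∀ w, 1 ≤ w → φ w = 0)
    (hΦ1 : ∀ w, 1 ≤ w → Φ w = 0) (ha : a ∈ Metric.ball (0 : Euc n) 1) (ht0 : 0 < t) (ht1 : t < 1) :
    tsupport (poleField φ Φ a t) ⊆ movingBall a t := by
  refine closure_minimal (fun x hx => ?_) (isCompact_movingBall ha ht0.le ht1).isClosed
  by_cases hxB : x ∈ Metric.ball (0 : Euc n) 1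
  · rw [mem_movingBall_iff hxB]
    by_contra! h1
    have h2 : 1 ≤ poleRatio a x / t := (one_le_div ht0).2 h1.le
    exact hx (by rw [poleField, if_pos hxB, hφ1 _ h2, hΦ1 _ h2]; simp)
  · exact absurd (by rw [poleField, if_neg hxB]) hx

/-- The extension by zero is harmless: for `t < 1` the support lies in a compact ball inside the
open unit ball, where the weight is positive. -/
theorem contDiff_poleField {φ Φ : ℝ → ℝ} (hφ : ContDiff ℝ 1 φ) (hΦ : ContDiff ℝ 1 Φ)
    (hφ1 : ∀ w, 1 ≤ w → φ w = 0) (hΦ1 : ∀ w, 1 ≤ w → Φ w = 0)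
    (ha : a ∈ Metric.ball (0 : Euc n) 1) (ht0 : 0 < t) (ht1 : t < 1) :
    ContDiff ℝ 1 (poleField φ Φ a t) := by
  refine contDiff_iff_contDiffAt.2 fun x => ?_
  by_cases hxB : x ∈ Metric.ball (0 : Euc n) 1
  · refine ContDiffAt.congr_of_eventuallyEq ?_ (poleField_eventuallyEq φ Φ hxB)
    have hu : ContDiffAt ℝ 1 (fun x => poleRatio a x / t) x :=
      ((contDiffAt_poleRatio hxB).of_le (by simp)).div_const t
    have h1 := hφ.contDiffAt.comp x hu
    have h2 := hΦ.contDiffAt.comp x hu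
    exact (h1.neg.smul (contDiffAt_id.sub contDiffAt_const)).add
      ((contDiffAt_const.mul h2).smul contDiffAt_const)
  · have hx' : x ∉ tsupport (poleField φ Φ a t) := fun hh => hxB
      (movingBall_subset_ball ha ht0.le ht1 (tsupport_poleField_subset hφ1 hΦ1 ha ht0 ht1 hh))
    exact (contDiffAt_const (c := (0 : Euc n))).congr_of_eventuallyEq
      (notMem_tsupport_iff_eventuallyEq.1 hx')

theorem IsMinimalSubmanifold.finrank_orthogonal_normalSpace (hM : IsMinimalSubmanifold m M)
    (hx : x ∈ M) : Module.finrank ℝ (normalSpace M x)ᗮ = m := by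
  obtain ⟨p, U, ρ, hmp, hxU, hρ⟩ := hM.exists_isOrthonormalSystem hx
  have h1 := hρ.finrank_normalSpace ⟨hx, hxU⟩
  have h2 := Submodule.finrank_add_finrank_orthogonal (normalSpace M x)
  rw [h1, finrank_euclideanSpace_fin] at h2
  omega

/-- With `P` the tangential projection, the gradient of `u` is `(2/l)(x - a + u a)`, and the choice
of `Φ` pairs it with `P(x - a) - u P a`. The cross terms cancel, leaving `(2/l)(|P(x - a)|² - u²|P
a|²)`, which is at most `2u` because `|P(x - a)|² ≤ |x - a|² = u l`. The sign of `φ'` turns this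
into the stated bound. -/
theorem IsMinimalSubmanifold.tangentialDivergence_poleField_le (hM : IsMinimalSubmanifold m M)
    (hxM : x ∈ M) (hx : x ∈ Metric.ball (0 : Euc n) 1) {φ Φ : ℝ → ℝ} (hφ : Differentiable ℝ φ)
    (hφ' : ∀ w, deriv φ w ≤ 0) (hΦ : ∀ w, HasDerivAt Φ (w * deriv φ w) w) (ht0 : 0 < t) :
    tangentialDivergence M (poleField φ Φ a t) x ≤
      -(m * φ (poleRatio a x / t) + 2 * (poleRatio a x / t * deriv φ (poleRatio a x / t))) := by
  set u := poleRatio a x with hu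
  set l := poleWeight a x with hl
  have hl0 : 0 < l := poleWeight_pos hx
  set L : StrongDual ℝ (Euc n) := (2 / l) • innerSL ℝ (x - a + u • a) with hL
  have h1 : HasFDerivAt (fun x => poleRatio a x / t) (t⁻¹ • L) x :=
    ((hasFDerivAt_poleRatio (a := a) hx).const_mul t⁻¹).congr_of_eventuallyEq
      (Eventually.of_forall fun y => div_eq_inv_mul _ _)
  have h2 : HasFDerivAt (fun x => φ (poleRatio a x / t)) (deriv φ (u / t) • (t⁻¹ • L)) x :=
    (hφ (u / t)).hasDerivAt.comp_hasFDerivAt x h1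
  have h3 : HasFDerivAt (fun x => Φ (poleRatio a x / t))
      ((u / t * deriv φ (u / t)) • (t⁻¹ • L)) x :=
    (hΦ (u / t)).comp_hasFDerivAt x h1
  have h4 := (h2.neg.smul ((hasFDerivAt_id x).sub_const a)).add
    ((h3.const_mul t).smul_const a)
  have h5 : HasFDerivAt (poleField φ Φ a t) _ x :=
    h4.congr_of_eventuallyEq (poleField_eventuallyEq φ Φ hx)
  rw [tangentialDivergence, h5.fderiv]
  set T := (normalSpace M x)ᗮ with hT
  have hfin : Module.finrank ℝ T = m := hM.finrank_orthogonal_normalSpace hxM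
  simp only [traceOn_add, traceOn_smul, traceOn_id, traceOn_smulRight, hfin]
  have hsym (y z : Euc n) : inner ℝ y (T.starProjection z) =
      inner ℝ (T.starProjection y) (T.starProjection z) := by
    rw [Submodule.inner_starProjection_left_eq_right,
      Submodule.starProjection_eq_self_iff.2 (T.starProjection_apply_mem z)]
  have i1 : inner ℝ (x - a) (T.starProjection (x - a)) = ‖T.starProjection (x - a)‖ ^ 2 := by
    rw [hsym, real_inner_self_eq_norm_sq]
  have i2 : inner ℝ a (T.starProjection a) = ‖T.starProjection a‖ ^ 2 := by
    rw [hsym, real_inner_self_eq_norm_sq]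
  have i3 : inner ℝ a (T.starProjection (x - a)) = inner ℝ (x - a) (T.starProjection a) := by
    rw [hsym, real_inner_comm, ← hsym]
  have hA : ‖T.starProjection (x - a)‖ ^ 2 ≤ u * l := by
    rw [hu, poleRatio, div_mul_cancel₀ _ hl0.ne']
    exact pow_le_pow_left₀ (norm_nonneg _) (T.norm_starProjection_apply_le _) 2
  have hdu : 0 ≤ -deriv φ (u / t) := neg_nonneg.2 (hφ' _)
  have hgoal : (2 / l) * (‖T.starProjection (x - a)‖ ^ 2 - u ^ 2 * ‖T.starProjection a‖ ^ 2) ≤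
      2 * u := by
    rw [div_mul_eq_mul_div, div_le_iff₀ hl0]
    nlinarith [mul_nonneg (sq_nonneg u) (sq_nonneg ‖T.starProjection a‖)]
  have hkey := mul_le_mul_of_nonneg_left hgoal (div_nonneg hdu ht0.le)
  simp only [hL, _root_.smul_apply, _root_.neg_apply, innerSL_apply_apply, smul_eq_mul, inner_add_left,
    inner_smul_left, RCLike.conj_to_real, i1, i2, i3, Pi.neg_apply, id_eq]
  have e1 : -deriv φ (u / t) / t * (2 * u) = -(2 * (u / t * deriv φ (u / t))) := by
    field_simp
  rw [e1] at hkey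
  refine le_of_eq_of_le ?_ (by linarith : -(m * φ (u / t)) + (-deriv φ (u / t) / t *
    (2 / l * (‖T.starProjection (x - a)‖ ^ 2 - u ^ 2 * ‖T.starProjection a‖ ^ 2))) ≤ _)
  field_simp
  ring

end MovingBalls

/-! ### Cutoff profiles. -/

/-- Smooth decreasing functions on the line which vanish on `[1, ∞)`. -/
structure IsCapProfile (φ : ℝ → ℝ) : Prop where
  contDiff : ContDiff ℝ ∞ φ
  antitone : Antitone φ
  eq_zero : ∀ w, 1 ≤ w → φ w = 0

section Profile

variable {φ : ℝ → ℝ} {w : ℝ}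

theorem IsCapProfile.nonneg (h : IsCapProfile φ) (w : ℝ) : 0 ≤ φ w := by
  rw [← h.eq_zero (max w 1) (le_max_right _ _)]
  exact h.antitone (le_max_left _ _)

theorem IsCapProfile.deriv_nonpos (h : IsCapProfile φ) (w : ℝ) : deriv φ w ≤ 0 :=
  h.antitone.deriv_nonpos

theorem IsCapProfile.deriv_eq_zero (h : IsCapProfile φ) (hw : 1 ≤ w) : deriv φ w = 0 := by
  have : IsLocalMin φ w := Eventually.of_forall fun y => by
    rw [h.eq_zero w hw]; exact h.nonneg y
  exact this.deriv_eq_zero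

theorem IsCapProfile.differentiable (h : IsCapProfile φ) : Differentiable ℝ φ :=
  h.contDiff.differentiable (by simp)

theorem IsCapProfile.continuous_deriv (h : IsCapProfile φ) : Continuous (deriv φ) :=
  h.contDiff.continuous_deriv (by simp)

/-- Integrating from `1` makes the primitive vanish on `[1, ∞)`, where `deriv φ` does. -/
theorem IsCapProfile.exists_primitive (h : IsCapProfile φ) : ∃ Φ : ℝ → ℝ, ContDiff ℝ 1 Φ ∧
    (∀ w, HasDerivAt Φ (w * deriv φ w) w) ∧ ∀ w, 1 ≤ w → Φ w = 0 := by
  have hc : Continuous fun w => w * deriv φ w := continuous_id.mul h.continuous_deriv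
  have hd (w) : HasDerivAt (fun w => ∫ s in (1 : ℝ)..w, s * deriv φ s) (w * deriv φ w) w :=
    (hc.integral_hasStrictDerivAt 1 w).hasDerivAt
  refine ⟨_, contDiff_one_iff_deriv.2 ⟨fun w => (hd w).differentiableAt, ?_⟩, hd, fun w hw => ?_⟩
  · rw [funext fun w => (hd w).deriv]; exact hc
  · have : Set.EqOn (fun s => s * deriv φ s) (fun _ => 0) (Set.uIcc 1 w) := fun s hs => by
      rw [Set.uIcc_of_le hw] at hs
      simp [h.deriv_eq_zero hs.1]
    simp [intervalIntegral.integral_congr this]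

theorem isCapProfile_smoothTransition {δ : ℝ} (hδ : 0 < δ) :
    IsCapProfile fun w => Real.smoothTransition ((1 - w) / δ) where
  contDiff := Real.smoothTransition.contDiff.comp ((contDiff_const.sub contDiff_id).div_const δ)
  antitone := fun x y hxy => Real.smoothTransition.monotone (by gcongr)
  eq_zero := fun w hw => Real.smoothTransition.zero_of_nonpos
    (div_nonpos_of_nonpos_of_nonneg (by linarith) hδ.le)

end Profile

/-! ### The monotonicity formula. -/

section Monotonicity

variable {n m : ℕ} {M : Set (Euc n)} {a : Euc n} {s t : ℝ} {φ : ℝ → ℝ}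

theorem exists_bound_of_eq_zero {g : ℝ → ℝ} (hg : Continuous g) (hg0 : ∀ w, 1 ≤ w → g w = 0) :
    ∃ C, ∀ w, 0 ≤ w → |g w| ≤ C := by
  obtain ⟨C, hC⟩ := (isCompact_Icc (a := (0 : ℝ)) (b := 1)).exists_bound_of_continuousOn
    hg.continuousOn
  refine ⟨C, fun w hw => ?_⟩
  rcases le_total w 1 with h1 | h1
  · exact hC w ⟨hw, h1⟩
  · rw [hg0 w h1, abs_zero]
    exact (norm_nonneg _).trans (hC 0 ⟨le_rfl, zero_le_one⟩)

theorem integrableOn_comp_poleRatio (hMB : M ⊆ Metric.ball 0 1) (hMm : MeasurableSet M)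
    (hfin : μHE[m] (M ∩ movingBall a s) < ⊤) (hEm : MeasurableSet (movingBall a s))
    {g : ℝ → ℝ} (hg : Continuous g) (hg0 : ∀ w, 1 ≤ w → g w = 0) (ht : 0 < t) :
    IntegrableOn (fun x => g (poleRatio a x / t)) (M ∩ movingBall a s) μHE[m] := by
  obtain ⟨C, hC⟩ := exists_bound_of_eq_zero hg hg0
  refine Measure.integrableOn_of_bounded (M := C) hfin.ne
    (hg.measurable.comp ((measurable_poleRatio a).div_const t)).aestronglyMeasurable ?_
  refine (ae_restrict_mem (hMm.inter hEm)).mono fun x hx => ?_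
  exact hC _ (div_nonneg (poleRatio_nonneg (hMB hx.1)) ht.le)

/-- Integrals are taken over a fixed larger ball `movingBall a s`, where `M` has finite measure, so
that the domain does not vary when `t` is differentiated. -/
theorem IsMinimalSubmanifold.setIntegral_poleRatio_le (hM : IsMinimalSubmanifold m M)
    (hMB : M ⊆ Metric.ball 0 1) (hcl : closure M ∩ Metric.ball 0 1 ⊆ M)
    (ha : a ∈ Metric.ball (0 : Euc n) 1) (hφ : IsCapProfile φ) (ht : 0 < t) (hts : t ≤ s)
    (hs : s < 1) :
    m * (∫ x in M ∩ movingBall a s, φ (poleRatio a x / t) ∂μHE[m]) +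
      2 * (∫ x in M ∩ movingBall a s,
        poleRatio a x / t * deriv φ (poleRatio a x / t) ∂μHE[m]) ≤ 0 := by
  have hMm := measurableSet_of_closure_inter_subset Metric.isOpen_ball hMB hcl
  have hE := isCompact_movingBall ha (ht.le.trans hts) hs
  have hfin := hM.measure_inter_lt_top Metric.isOpen_ball hMB hcl hE
    (movingBall_subset_ball ha (ht.le.trans hts) hs)
  obtain ⟨Φ, hΦC, hΦ, hΦ0⟩ := hφ.exists_primitive
  have hts1 := hts.trans_lt hs
  have hsupp := tsupport_poleField_subset (t := t) hφ.eq_zero hΦ0 ha ht hts1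
  have hW := contDiff_poleField (t := t) (hφ.contDiff.of_le (by simp)) hΦC hφ.eq_zero hΦ0 ha ht hts1
  obtain ⟨hint, hzero⟩ := hM.integral_tangentialDivergence_eq_zero Metric.isOpen_ball hMB hcl hW
    ((isCompact_movingBall ha ht.le hts1).of_isClosed_subset (isClosed_tsupport _) hsupp)
    (hsupp.trans (movingBall_subset_ball ha ht.le hts1))
  have hi1 := integrableOn_comp_poleRatio (m := m) hMB hMm hfin hE.measurableSet
    hφ.contDiff.continuous hφ.eq_zero ht
  have hgc : Continuous fun w => w * deriv φ w := continuous_id.mul hφ.continuous_deriv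
  have hi2 : IntegrableOn (fun x => poleRatio a x / t * deriv φ (poleRatio a x / t))
      (M ∩ movingBall a s) μHE[m] :=
    integrableOn_comp_poleRatio (g := fun w => w * deriv φ w) hMB hMm hfin hE.measurableSet hgc
      (fun w hw => by simp [hφ.deriv_eq_zero hw]) ht
  have hout : ∀ x ∈ M \ (M ∩ movingBall a s), tangentialDivergence M (poleField φ Φ a t) x = 0 := by
    rintro x ⟨hxM, hx⟩
    refine tangentialDivergence_eq_zero fun hh => hx ⟨hxM, ?_⟩
    have h1 := (mem_movingBall_iff (hMB hxM)).1 (hsupp hh)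
    exact (mem_movingBall_iff (hMB hxM)).2 (h1.trans hts)
  rw [setIntegral_eq_of_subset_of_forall_sdiff_eq_zero hMm Set.inter_subset_left hout] at hzero
  have hle : 0 ≤ ∫ x in M ∩ movingBall a s, -(m * φ (poleRatio a x / t) +
      2 * (poleRatio a x / t * deriv φ (poleRatio a x / t))) ∂μHE[m] := by
    rw [← hzero]
    refine setIntegral_mono_on (hint.mono_set Set.inter_subset_left)
      ((hi1.const_mul (m : ℝ)).add (hi2.const_mul 2)).neg (hMm.inter hE.measurableSet)
      fun x hx => ?_
    exact hM.tangentialDivergence_poleField_le hx.1 (hMB hx.1) hφ.differentiable hφ.deriv_nonpos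
      hΦ ht
  rw [integral_neg, integral_add (hi1.const_mul (m : ℝ)) (hi2.const_mul 2), integral_const_mul,
    integral_const_mul] at hle
  linarith

theorem hasDerivAt_setIntegral_poleRatio (hMB : M ⊆ Metric.ball 0 1) (hMm : MeasurableSet M)
    (hfin : μHE[m] (M ∩ movingBall a s) < ⊤) (hEm : MeasurableSet (movingBall a s))
    (hφ : IsCapProfile φ) (ht : 0 < t) :
    HasDerivAt (fun t => ∫ x in M ∩ movingBall a s, φ (poleRatio a x / t) ∂μHE[m])
      (∫ x in M ∩ movingBall a s,
        -t⁻¹ * (poleRatio a x / t * deriv φ (poleRatio a x / t)) ∂μHE[m]) t := by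
  have hgc : Continuous fun w => w * deriv φ w := continuous_id.mul hφ.continuous_deriv
  have hg0 (w : ℝ) (hw : 1 ≤ w) : w * deriv φ w = 0 := by simp [hφ.deriv_eq_zero hw]
  obtain ⟨C, hC⟩ := exists_bound_of_eq_zero hgc hg0
  have hmeas (r : ℝ) : Measurable fun x : Euc n => poleRatio a x / r :=
    (measurable_poleRatio a).div_const r
  have : Fact (μHE[m] (M ∩ movingBall a s) < ⊤) := ⟨hfin⟩
  -- Restricting to `r > t / 2` bounds the factor `r⁻¹`; the other factor is bounded by `C`
  -- uniformly, since `w * deriv φ w` vanishes for `w ≥ 1`.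
  refine (hasDerivAt_integral_of_dominated_loc_of_deriv_le (s := Set.Ioi (t / 2))
    (bound := fun _ => (t / 2)⁻¹ * C)
    (F := fun t x => φ (poleRatio a x / t))
    (F' := fun r x => -r⁻¹ * (poleRatio a x / r * deriv φ (poleRatio a x / r)))
    (Ioi_mem_nhds (by linarith))
    (Eventually.of_forall fun r =>
      (hφ.contDiff.continuous.measurable.comp (hmeas r)).aestronglyMeasurable)
    (integrableOn_comp_poleRatio hMB hMm hfin hEm hφ.contDiff.continuous hφ.eq_zero ht)
    (((hgc.measurable.comp (hmeas t)).const_mul (-t⁻¹)).aestronglyMeasurable)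
    ?_ (integrable_const _) ?_).2
  · refine (ae_restrict_mem (hMm.inter hEm)).mono fun x hx r hr => ?_
    have hr' : t / 2 < r := hr
    have hr0 : 0 < r := by linarith
    rw [norm_mul, norm_neg, norm_inv, Real.norm_of_nonneg hr0.le]
    have h1 := hC _ (div_nonneg (poleRatio_nonneg (a := a) (hMB hx.1)) hr0.le)
    have h2 : r⁻¹ ≤ (t / 2)⁻¹ := inv_anti₀ (by positivity) hr'.le
    exact mul_le_mul h2 h1 (norm_nonneg _) (by positivity)
  · refine Eventually.of_forall fun x r hr => ?_
    have hr' : t / 2 < r := hr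
    have hr0 : r ≠ 0 := by
      have : 0 < r := by linarith
      exact this.ne'
    have h1 : HasDerivAt (fun r => poleRatio a x / r) (-poleRatio a x / r ^ 2) r := by
      have := (hasDerivAt_inv hr0).const_mul (poleRatio a x)
      refine (this.congr_deriv ?_).congr_of_eventuallyEq
        (Eventually.of_forall fun y => div_eq_mul_inv _ _)
      field_simp
    refine ((hφ.differentiable _).hasDerivAt.comp r h1).congr_deriv ?_
    field_simp

/-- The monotonicity formula for the balls `movingBall a t`. -/
theorem IsMinimalSubmanifold.monotoneOn_poleRatio (hM : IsMinimalSubmanifold m M)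
    (hMB : M ⊆ Metric.ball 0 1) (hcl : closure M ∩ Metric.ball 0 1 ⊆ M)
    (ha : a ∈ Metric.ball (0 : Euc n) 1) (hφ : IsCapProfile φ) (hs0 : 0 ≤ s) (hs : s < 1) :
    MonotoneOn (fun t => t ^ (-((m : ℝ) / 2)) *
      ∫ x in M ∩ movingBall a s, φ (poleRatio a x / t) ∂μHE[m]) (Set.Ioo 0 s) := by
  have hMm := measurableSet_of_closure_inter_subset Metric.isOpen_ball hMB hcl
  have hE := isCompact_movingBall ha hs0 hs
  have hfin := hM.measure_inter_lt_top Metric.isOpen_ball hMB hcl hE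
    (movingBall_subset_ball ha hs0 hs)
  have hd (t : ℝ) (ht : 0 < t) := (Real.hasDerivAt_rpow_const (p := -((m : ℝ) / 2))
    (Or.inl ht.ne')).mul
    (hasDerivAt_setIntegral_poleRatio (m := m) hMB hMm hfin hE.measurableSet hφ ht)
  refine monotoneOn_of_deriv_nonneg (convex_Ioo 0 s)
    (fun t ht => (hd t ht.1).continuousAt.continuousWithinAt)
    (fun t ht => ((hd t (interior_subset ht).1).differentiableAt).differentiableWithinAt)
    fun t ht => ?_
  rw [interior_Ioo] at ht
  have h1 := hM.setIntegral_poleRatio_le hMB hcl ha hφ ht.1 ht.2.le hs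
  refine le_of_le_of_eq ?_ (hd t ht.1).deriv.symm
  rw [integral_const_mul, Real.rpow_sub_one ht.1.ne']
  have h2 : 0 < t ^ (-((m : ℝ) / 2)) / t := div_pos (Real.rpow_pos_of_pos ht.1 _) ht.1
  -- The derivative is `t ^ (-m/2 - 1)` times `-(m ∫ φ + 2 ∫ w φ') / 2`.
  have h3 := mul_nonneg h2.le (by linarith : 0 ≤ -(m * (∫ x in M ∩ movingBall a s,
    φ (poleRatio a x / t) ∂μHE[m]) + 2 * (∫ x in M ∩ movingBall a s,
        poleRatio a x / t * deriv φ (poleRatio a x / t) ∂μHE[m])) / 2)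
  refine h3.trans_eq ?_
  have := ht.1.ne'
  field_simp
  ring

end Monotonicity

/-! ### Density at `a` and the limit along the moving balls. -/

section Density

variable {n m : ℕ} {M : Set (Euc n)} {a : Euc n}

/-- The lower bound for the `m`-dimensional density at a point. -/
theorem IsMinimalSubmanifold.eventually_volume_le (hM : IsMinimalSubmanifold m M)
    (hMB : M ⊆ Metric.ball 0 1) (ha : a ∈ M) {θ : ℝ} (hθ0 : 0 < θ) (hθ1 : θ < 1) :
    ∀ᶠ s in 𝓝[>] (0 : ℝ), volume (Metric.ball (0 : Euc m) 1) *
      ENNReal.ofReal ((θ * (s * (1 - ‖a‖ ^ 2))) ^ ((m : ℝ) / 2)) ≤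
        μHE[m] (M ∩ movingBall a s) := by
  have haB := hMB ha
  have hl0 : 0 < 1 - ‖a‖ ^ 2 := by
    rw [← poleWeight_self]; exact poleWeight_pos haB
  obtain ⟨p, U, ρ, hmp, haU, hρ⟩ := hM.exists_isOrthonormalSystem ha
  -- The slack `θ < 1` pays for the chart distortion `δ²` and for the variation of the weight near
  -- `a`.
  obtain ⟨δ, hδ1, hδθ⟩ : ∃ δ : ℝ≥0, 1 < δ ∧ (δ : ℝ) ^ 2 * θ < 1 := by
    have h1 : Tendsto (fun δ : ℝ≥0 => (δ : ℝ) ^ 2 * θ) (𝓝[>] 1) (𝓝 θ) := by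
      have := (((NNReal.continuous_coe.pow 2).mul_const θ).tendsto 1).mono_left
        (nhdsWithin_le_nhds (s := Set.Ioi (1 : ℝ≥0)))
      simpa using this
    obtain ⟨δ, h2, h3⟩ := ((h1.eventually (gt_mem_nhds hθ1)).and self_mem_nhdsWithin).exists
    exact ⟨δ, h3, h2⟩
  obtain ⟨P, φ, haφ, -, hφ⟩ := hρ.exists_isFlatteningChart hmp ⟨ha, haU⟩ hδ1
  have hφa : φ a = (P a, 0) := by rw [hφ.apply_eq, (hφ.mem_iff a haφ).1 ha]
  have hPa : (P a, (0 : Euc p)) ∈ φ.target := hφa ▸ φ.map_source haφ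
  have hsymm : φ.symm (P a, 0) = a := by rw [← hφa, φ.left_inv haφ]
  have hcont : ContinuousAt (fun z : Euc m => φ.symm (z, 0)) (P a) :=
    (φ.continuousAt_symm hPa).comp (f := fun z : Euc m => (z, (0 : Euc p)))
      (by fun_prop : Continuous fun z : Euc m => (z, (0 : Euc p))).continuousAt
  have hw : ∀ᶠ z in 𝓝 (P a), (δ : ℝ) ^ 2 * θ * (1 - ‖a‖ ^ 2) <
      poleWeight a (φ.symm (z, 0)) := by
    have h1 : Tendsto (fun z : Euc m => poleWeight a (φ.symm (z, 0))) (𝓝 (P a))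
        (𝓝 (1 - ‖a‖ ^ 2)) := by
      have := (continuous_poleWeight a).continuousAt.tendsto.comp hcont.tendsto
      rwa [hsymm, poleWeight_self] at this
    exact h1.eventually (lt_mem_nhds (by nlinarith))
  have htar : ∀ᶠ z in 𝓝 (P a), (z, (0 : Euc p)) ∈ φ.target :=
    (by fun_prop : Continuous fun z : Euc m => (z, (0 : Euc p))).continuousAt.eventually
      (φ.open_target.mem_nhds hPa)
  obtain ⟨r, hr, hball⟩ := Metric.eventually_nhds_iff_ball.1 (hw.and htar)
  have hrad : Tendsto (fun s : ℝ => √(θ * (s * (1 - ‖a‖ ^ 2)))) (𝓝[>] 0) (𝓝 0) := by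
    have h1 : Continuous fun s : ℝ => √(θ * (s * (1 - ‖a‖ ^ 2))) := by fun_prop
    have := (h1.tendsto 0).mono_left (nhdsWithin_le_nhds (s := Set.Ioi (0 : ℝ)))
    simpa using this
  filter_upwards [hrad.eventually (gt_mem_nhds hr), self_mem_nhdsWithin] with s hsr hs
  have hs0 : 0 < s := hs
  -- The disc of radius `R` about `P a` lifts to points of `M` within `δ R` of `a`, and `δ² θ (1 -
  -- |a|²)` is below the weight at those points; so they lie in `movingBall a s`.
  set R := √(θ * (s * (1 - ‖a‖ ^ 2))) with hR
  have hR2 : R ^ 2 = θ * (s * (1 - ‖a‖ ^ 2)) := Real.sq_sqrt (by positivity)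
  have hR0 : 0 < R := Real.sqrt_pos.2 (by positivity)
  have hsub : Metric.ball (P a) R ⊆ {z | (z, 0) ∈ φ.target} := fun z hz =>
    (hball z (Metric.ball_subset_ball hsr.le hz)).2
  have hvol : volume (Metric.ball (P a) R) =
      volume (Metric.ball (0 : Euc m) 1) *
      ENNReal.ofReal ((θ * (s * (1 - ‖a‖ ^ 2))) ^ ((m : ℝ) / 2)) := by
    rw [Measure.addHaar_ball_of_pos _ _ hR0, finrank_euclideanSpace_fin, mul_comm, ← hR2,
      ← Real.rpow_natCast R 2, ← Real.rpow_mul hR0.le, ← Real.rpow_natCast R m]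
    congr 3
    push_cast
    ring
  rw [← hvol]
  have h2 := hφ.le_euclideanHausdorffMeasure (Metric.ball (P a) R)
  rw [Set.inter_eq_left.2 hsub] at h2
  refine h2.trans (measure_mono ?_)
  rw [hφ.source_inter_preimage]
  rintro _ ⟨z, ⟨hzR, hz⟩, rfl⟩
  have hzM : φ.symm (z, 0) ∈ M := by
    have := (hφ.source_inter_preimage {z}).symm ▸
      (Set.mem_image_of_mem (fun z => φ.symm (z, (0 : Euc p)))
        (⟨rfl, hz⟩ : z ∈ {z} ∩ {z | (z, 0) ∈ φ.target}))
    exact this.2.1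
  refine ⟨hzM, ?_⟩
  have h3 := hφ.lipschitz.dist_le_mul z hz (P a) hPa
  simp only [hsymm] at h3
  rw [dist_eq_norm] at h3
  have h4 : ‖φ.symm (z, 0) - a‖ ^ 2 ≤ (δ * R) ^ 2 :=
    pow_le_pow_left₀ (norm_nonneg _) (h3.trans
      (mul_le_mul_of_nonneg_left (Metric.mem_ball.1 hzR).le δ.2)) 2
  have h5 := (hball z (Metric.ball_subset_ball hsr.le hzR)).1
  change ‖φ.symm (z, 0) - a‖ ^ 2 ≤ s * poleWeight a (φ.symm (z, 0))
  rw [mul_pow, hR2] at h4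
  calc _ ≤ _ := h4
    _ = s * ((δ : ℝ) ^ 2 * θ * (1 - ‖a‖ ^ 2)) := by ring
    _ ≤ _ := mul_le_mul_of_nonneg_left h5.le hs0.le

theorem IsMinimalSubmanifold.volume_mul_le (hM : IsMinimalSubmanifold m M)
    (hMB : M ⊆ Metric.ball 0 1) (hcl : closure M ∩ Metric.ball 0 1 ⊆ M) (ha : a ∈ M) {θ : ℝ}
    (hθ0 : 0 < θ) (hθ1 : θ < 1) :
    volume (Metric.ball (0 : Euc m) 1) *
      ENNReal.ofReal ((θ ^ 3 * (1 - ‖a‖ ^ 2)) ^ ((m : ℝ) / 2)) ≤ μHE[m] M := by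
  have haB := hMB ha
  have hl0 : 0 < 1 - ‖a‖ ^ 2 := by
    rw [← poleWeight_self]; exact poleWeight_pos haB
  have hMm := measurableSet_of_closure_inter_subset Metric.isOpen_ball hMB hcl
  -- Any `s` strictly between `θ` and `1` serves: `θ` must be interior to the interval of
  -- monotonicity.
  set s := (1 + θ) / 2 with hs
  have hs1 : s < 1 := by rw [hs]; linarith
  have hθs : θ < s := by rw [hs]; linarith
  have hs0 : 0 ≤ s := by linarith
  have hE := isCompact_movingBall haB hs0 hs1
  have hfin := hM.measure_inter_lt_top Metric.isOpen_ball hMB hcl hE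
    (movingBall_subset_ball haB hs0 hs1)
  -- This cutoff equals `1` for `w ≤ θ` and `0` for `w ≥ 1`.
  have hφ := isCapProfile_smoothTransition (δ := 1 - θ) (by linarith)
  set φ : ℝ → ℝ := fun w => Real.smoothTransition ((1 - w) / (1 - θ)) with hφdef
  have hmono := hM.monotoneOn_poleRatio hMB hcl haB hφ hs0 hs1
  have hdens := hM.eventually_volume_le hMB ha hθ0 hθ1
  have hscale : Tendsto (fun t : ℝ => θ * t) (𝓝[>] 0) (𝓝[>] 0) := by
    refine tendsto_nhdsWithin_of_tendsto_nhds_of_eventually_within _ ?_ ?_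
    · have h1 : Continuous fun t : ℝ => θ * t := by fun_prop
      have := (h1.tendsto 0).mono_left (nhdsWithin_le_nhds (s := Set.Ioi (0 : ℝ)))
      simpa using this
    · filter_upwards [self_mem_nhdsWithin] with t ht
      exact mul_pos hθ0 ht
  -- Monotonicity is applied between a small `t` and `θ`. The three factors `θ` in the bound come
  -- from the density estimate, from using it at `θ * t` where the cutoff is `1`, and from stopping
  -- at `θ` instead of `1`.
  obtain ⟨t, ⟨htd, htθ⟩, ht⟩ := ((hscale.eventually hdens).and
    (nhdsWithin_le_nhds (gt_mem_nhds hθ0))).and self_mem_nhdsWithin |>.exists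
  have ht0 : 0 < t := ht
  have hle := hmono ⟨ht0, htθ.trans hθs⟩ ⟨hθ0, hθs⟩ htθ.le
  simp only at hle
  set A := M ∩ movingBall a (θ * t) with hA
  have hAE : A ⊆ M ∩ movingBall a s := by
    rintro x ⟨hxM, hx⟩
    refine ⟨hxM, (mem_movingBall_iff (hMB hxM)).2 (((mem_movingBall_iff (hMB hxM)).1 hx).trans ?_)⟩
    nlinarith
  have hAm : MeasurableSet A := hMm.inter
    (isCompact_movingBall haB (by positivity) (by nlinarith)).measurableSet
  have hint (r : ℝ) (hr : 0 < r) := integrableOn_comp_poleRatio (m := m) hMB hMm hfin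
    hE.measurableSet hφ.contDiff.continuous hφ.eq_zero hr
  have hlow : (μHE[m]).real A ≤ ∫ x in M ∩ movingBall a s, φ (poleRatio a x / t) ∂μHE[m] := by
    calc (μHE[m]).real A = ∫ x in A, (1 : ℝ) ∂μHE[m] := by simp
      _ ≤ ∫ x in A, φ (poleRatio a x / t) ∂μHE[m] := by
        refine setIntegral_mono_on (integrableOn_const ((measure_mono hAE).trans_lt hfin).ne)
          ((hint t ht0).mono_set hAE) hAm fun x hx => ?_
        have h1 := (mem_movingBall_iff (hMB hx.1)).1 hx.2
        have h2 : poleRatio a x / t ≤ θ := (div_le_iff₀ ht0).2 h1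
        refine (Real.smoothTransition.one_of_one_le ?_).ge
        rw [one_le_div (by linarith)]
        linarith
      _ ≤ _ := setIntegral_mono_set (hint t ht0) (Eventually.of_forall fun x => hφ.nonneg _)
        hAE.eventuallyLE
  have hup : ∫ x in M ∩ movingBall a s, φ (poleRatio a x / θ) ∂μHE[m] ≤
      (μHE[m]).real (M ∩ movingBall a s) := by
    calc _ ≤ ∫ x in M ∩ movingBall a s, (1 : ℝ) ∂μHE[m] :=
        setIntegral_mono_on (hint θ hθ0) (integrableOn_const hfin.ne)
          (hMm.inter hE.measurableSet) fun x _ => Real.smoothTransition.le_one _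
      _ = _ := by simp
  have htm : 0 < t ^ (-((m : ℝ) / 2)) := Real.rpow_pos_of_pos ht0 _
  have hθm : 0 < θ ^ (-((m : ℝ) / 2)) := Real.rpow_pos_of_pos hθ0 _
  have hchain : t ^ (-((m : ℝ) / 2)) * (μHE[m]).real A ≤
      θ ^ (-((m : ℝ) / 2)) * (μHE[m]).real (M ∩ movingBall a s) :=
    (mul_le_mul_of_nonneg_left hlow htm.le).trans
      (hle.trans (mul_le_mul_of_nonneg_left hup hθm.le))
  set c₀ := volume (Metric.ball (0 : Euc m) 1) with hc₀
  have hcfin : c₀ ≠ ⊤ := measure_ball_lt_top.ne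
  have hAfin : μHE[m] A ≠ ⊤ := ((measure_mono hAE).trans_lt hfin).ne
  have hreal : c₀.toReal * (θ * (θ * t * (1 - ‖a‖ ^ 2))) ^ ((m : ℝ) / 2) ≤ (μHE[m]).real A := by
    have h1 := ENNReal.toReal_mono hAfin htd
    rwa [ENNReal.toReal_mul, ENNReal.toReal_ofReal (by positivity)] at h1
  have hfinal : c₀.toReal * (θ ^ 3 * (1 - ‖a‖ ^ 2)) ^ ((m : ℝ) / 2) ≤
      (μHE[m]).real (M ∩ movingBall a s) := by
    have h1 := (mul_le_mul_of_nonneg_left hreal htm.le).trans hchain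
    have e1 : (θ * (θ * t * (1 - ‖a‖ ^ 2))) ^ ((m : ℝ) / 2) =
        θ ^ (-((m : ℝ) / 2)) * (θ ^ 3 * (1 - ‖a‖ ^ 2)) ^ ((m : ℝ) / 2) * t ^ ((m : ℝ) / 2) := by
      rw [show θ * (θ * t * (1 - ‖a‖ ^ 2)) = θ⁻¹ * (θ ^ 3 * (1 - ‖a‖ ^ 2)) * t by
        field_simp]
      rw [Real.mul_rpow (by positivity) ht0.le, Real.mul_rpow (by positivity) (by positivity),
        Real.inv_rpow hθ0.le, Real.rpow_neg hθ0.le]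
    rw [e1] at h1
    have e2 : t ^ (-((m : ℝ) / 2)) * t ^ ((m : ℝ) / 2) = 1 := by
      rw [← Real.rpow_add ht0]; simp
    have e3 : t ^ (-((m : ℝ) / 2)) * (c₀.toReal * (θ ^ (-((m : ℝ) / 2)) *
        (θ ^ 3 * (1 - ‖a‖ ^ 2)) ^ ((m : ℝ) / 2) * t ^ ((m : ℝ) / 2))) =
        θ ^ (-((m : ℝ) / 2)) * (c₀.toReal * (θ ^ 3 * (1 - ‖a‖ ^ 2)) ^ ((m : ℝ) / 2)) *
        (t ^ (-((m : ℝ) / 2)) * t ^ ((m : ℝ) / 2)) := by ring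
    rw [e3, e2, mul_one] at h1
    exact le_of_mul_le_mul_left h1 hθm
  calc c₀ * ENNReal.ofReal ((θ ^ 3 * (1 - ‖a‖ ^ 2)) ^ ((m : ℝ) / 2))
      = ENNReal.ofReal (c₀.toReal * (θ ^ 3 * (1 - ‖a‖ ^ 2)) ^ ((m : ℝ) / 2)) := by
        rw [ENNReal.ofReal_mul ENNReal.toReal_nonneg, ENNReal.ofReal_toReal hcfin]
    _ ≤ ENNReal.ofReal ((μHE[m]).real (M ∩ movingBall a s)) := ENNReal.ofReal_le_ofReal hfinal
    _ = μHE[m] (M ∩ movingBall a s) := ENNReal.ofReal_toReal hfin.ne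
    _ ≤ μHE[m] M := measure_mono Set.inter_subset_left

end Density

/-- The `m`-dimensional volume is the Hausdorff measure `μHE[m]`, normalized so that it is Lebesgue
measure on `ℝᵐ`; it is allowed to be infinite. The submanifold has no boundary inside the open
unit ball: it is relatively closed there. -/
theorem corollary6p4 (n m : ℕ) (M : Set (EuclideanSpace ℝ (Fin n)))
    (hM : IsMinimalSubmanifold m M)
    (hM_ball : M ⊆ Metric.ball 0 1)
    (hM_closed : closure M ∩ Metric.ball 0 1 ⊆ M)
    (a : EuclideanSpace ℝ (Fin n)) (ha : a ∈ M) :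
    volume (Metric.ball (0 : EuclideanSpace ℝ (Fin m)) 1)
        * ENNReal.ofReal ((1 - ‖a‖ ^ 2) ^ ((m : ℝ) / 2))
      ≤ μHE[m] M := by
  -- The loss `θ ^ 3` disappears as `θ → 1`.
  have hlim : Tendsto (fun θ : ℝ => volume (Metric.ball (0 : Euc m) 1) *
      ENNReal.ofReal ((θ ^ 3 * (1 - ‖a‖ ^ 2)) ^ ((m : ℝ) / 2))) (𝓝[<] 1)
      (𝓝 (volume (Metric.ball (0 : Euc m) 1) *
        ENNReal.ofReal ((1 - ‖a‖ ^ 2) ^ ((m : ℝ) / 2)))) := by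
    refine ENNReal.Tendsto.const_mul ?_ (Or.inr measure_ball_lt_top.ne)
    have h1 : Continuous fun θ : ℝ => ENNReal.ofReal ((θ ^ 3 * (1 - ‖a‖ ^ 2)) ^ ((m : ℝ) / 2)) :=
      ENNReal.continuous_ofReal.comp ((by fun_prop : Continuous fun θ : ℝ =>
        θ ^ 3 * (1 - ‖a‖ ^ 2)).rpow_const fun _ => Or.inr (by positivity))
    have := (h1.tendsto 1).mono_left (nhdsWithin_le_nhds (s := Set.Iio (1 : ℝ)))
    simpa using this
  refine le_of_tendsto hlim ?_
  filter_upwards [self_mem_nhdsWithin, nhdsWithin_le_nhds (lt_mem_nhds zero_lt_one)]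
    with θ hθ1 hθ0
  exact hM.volume_mul_le hM_ball hM_closed ha hθ0 hθ1
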